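/- **Setting.** Let $\mathcal X$ be a measurable space with a $\sigma$-finite reference measure $\mu$ (counting measure if $\mathcal X$ is discrete), let $U\subset\mathbb R^k$ be open and let $\Theta_k\subset U$ be compact with non-empty interior. For $i=1,2,\dots$ and $\theta\in U$ let $q_i(\cdot;\theta)>0$ be a probability density with respect to $\mu$, and for $\boldsymbol x\in\mathcal X^n$ put $p(\boldsymbol x;\theta)=\prod_{i=1}^n q_i(x_i;\theta)$ (independent observations, not necessarily identically distributed). Let $\mathcal P_k=\{p(\cdot;\theta):\theta\in\Theta_k\}$, let $\hat\theta(\boldsymbol x)\in\Theta_k$ be a (measurable) maximum likelihood estimator over $\Theta_k$, and let $g(\cdot,\theta)$ be the distribution of $\hat\theta$ under $p(\cdot;\theta)$. Define $$C_n(\mathcal P_k)=\int \sup_{\theta\in\Theta_k}p(\boldsymbol y;\theta)\,\mu^n(d\boldsymbol y),\qquad d_n(\theta',\theta)=\tfrac1n\,\mathrm{KL}\bigl(p(\cdot;\theta')\,\|\,p(\cdot;\theta)\bigr),$$ $$D_\epsilon(\theta')=\{\theta\in\Theta_k: d_n(\theta',\theta)\le\epsilon^2\},\qquad Q_\epsilon(\theta')=\int_{\{\boldsymbol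 y:\ \hat\theta(\boldsymbol y)\in D_\epsilon(\theta')\}}p(\boldsymbol y;\hat\theta(\boldsymbol y))\,\mu^n(d\boldsymbol y)\quad\Bigl(=\int_{D_\epsilon(\theta')}g(\hat\theta,\hat\theta)\,d\hat\theta\Bigr),$$ and let $m_n(\epsilon:\mathcal P_k)$ be the least cardinality of a finite set $\overline\Theta\subset\Theta_k$ with $C_n(\mathcal P_k)\le\sum_{\theta'\in\overline\Theta}Q_\epsilon(\theta')$. Let $I_n(\theta)=\frac1n E_\theta[-\partial^2\log p(\boldsymbol x;\theta)/\partial\theta\,\partial\theta^\top]$. **Theorem.** Assume: 1. each $\log q_i(x;\theta)$ is three times continuously differentiable in $\theta\in U$, and there are measurable $h_i\ge0$ on $\mathcal X$ and $\tau>0$, $B<\infty$ such that the norms of the second and third $\theta$-derivatives of $\log q_i(x;\theta)$ are at most $h_i(x)$ for all $i$, $x$ and $\theta\in U$, and $\int e^{\tau h_i(x)}q_i(x;\theta)\,\mu(dx)\le B$ for all $i$ and $\theta\in U$ (for instance, these derivatives are uniformly bounded); 2. for each $\theta\in\Theta_k$, $I_n(\theta)$ converges to a positive definite matrix $I(\theta)$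 as $n\to\infty$; 3. (central limit theorem for the maximum likelihood estimator) for each $\theta$ in the interior of $\Theta_k$, under $p(\cdot;\theta)$ the variable $\sqrt n(\hat\theta-\theta)$ converges in law to the Gaussian distribution with density $(2\pi)^{-k/2}|I(\theta)|^{1/2}e^{-u^\top I(\theta)u/2}$; that is, $g(\cdot,\theta)$ is asymptotically, in law, the Gaussian with density $(n/2\pi)^{k/2}|I(\theta)|^{1/2}e^{-n(\hat\theta-\theta)^\top I(\theta)(\hat\theta-\theta)/2}$. Then for every $c>0$ and $\epsilon_1>0$ there are $K$ and $N$ such that, for all $n\ge N$ and all $\epsilon\in(0,\epsilon_1]$ with $\epsilon^2n\ge c$, the complexity $C_n(\mathcal P_k)$ is finite, a finite set $\overline\Theta$ as in the definition of $m_n$ exists, and $$\Bigl|\log C_n(\mathcal P_k)-\log m_n(\epsilon:\mathcal P_k)-\frac k2\log(\epsilon^2n)\Bigr|\le K .$$ That is, $\log C_n(\mathcal P_k)=\log m_n(\epsilon:\mathcal P_k)+\frac k2\log(\epsilon^2n)+O(1)$, where the $O(1)$ term depends on neither $n$ nor $\epsilon$. In particular this holds for each fixed $\epsilon\le\epsilon_1$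 once $n$ is large, and for $\epsilon=\epsilon_n$ with $\epsilon_n^2n=\Theta(1)$. -/

import Mathlib

open MeasureTheory Filter Topology
open scoped ENNReal

namespace DescriptiveDim

noncomputable section

/-- The parameter space `ℝ^k` with its Euclidean norm. -/
abbrev Param (k : ℕ) : Type := EuclideanSpace ℝ (Fin k)

/-- Joint density `p(x; θ) = ∏ i, q i (x i) θ` of `n` independent observations, where
`q i · θ` is the density (probability mass function, if the reference measure is counting
measure) of the `i`-th observation. -/
def jointDensity {X : Type*} {k : ℕ} (q : ℕ → X → Param k → ℝ) (n : ℕ)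
    (y : Fin n → X) (θ : Param k) : ℝ :=
  ∏ i : Fin n, q i (y i) θ

/-- The distribution `p_θ` on `X^n`. -/
def dist {X : Type*} [MeasurableSpace X] {k : ℕ} (μ : Measure X) (q : ℕ → X → Param k → ℝ)
    (n : ℕ) (θ : Param k) : Measure (Fin n → X) :=
  (Measure.pi fun _ : Fin n => μ).withDensity
    (fun y => ENNReal.ofReal (jointDensity q n y θ))

/-- The parametric complexity `C_n`: the integral (the sum, for counting measure)
over `y` of the maximum likelihood `sup_{θ ∈ Θ} p(y; θ)`. -/
def complexity {X : Type*} [MeasurableSpace X] {k : ℕ} (μ : Measure X)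
    (q : ℕ → X → Param k → ℝ) (Θ : Set (Param k)) (n : ℕ) : ℝ≥0∞ :=
  ∫⁻ y, ⨆ θ ∈ Θ, ENNReal.ofReal (jointDensity q n y θ) ∂(Measure.pi fun _ : Fin n => μ)

/-- `(1/n) KL(p_{θ₀} ‖ p_θ)`, with value `∞` if the divergence is infinite. -/
def normalizedKL {X : Type*} [MeasurableSpace X] {k : ℕ} (μ : Measure X)
    (q : ℕ → X → Param k → ℝ) (n : ℕ) (θ₀ θ : Param k) : ℝ≥0∞ :=
  InformationTheory.klDiv (dist μ q n θ₀) (dist μ q n θ) / (n : ℝ≥0∞)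

/-- The Kullback-Leibler ball of parameters `θ ∈ Θ` with `d_n(p_{θ₀}, p_θ) ≤ ε ^ 2`. -/
def klBall {X : Type*} [MeasurableSpace X] {k : ℕ} (μ : Measure X)
    (q : ℕ → X → Param k → ℝ) (Θ : Set (Param k)) (n : ℕ) (ε : ℝ) (θ₀ : Param k) :
    Set (Param k) :=
  {θ | θ ∈ Θ ∧ normalizedKL μ q n θ₀ θ ≤ ENNReal.ofReal (ε ^ 2)}

/-- `mle n` is a maximum likelihood estimator over `Θ` at sample size `n`, for every `n`. -/
structure IsMLE {X : Type*} [MeasurableSpace X] {k : ℕ} (q : ℕ → X → Param k → ℝ)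
    (Θ : Set (Param k)) (mle : (n : ℕ) → (Fin n → X) → Param k) : Prop where
  measurable : ∀ n, Measurable (mle n)
  mem : ∀ n y, mle n y ∈ Θ
  isMax : ∀ n y, ∀ θ ∈ Θ, jointDensity q n y θ ≤ jointDensity q n y (mle n y)

/-- `Q_ε(θ₀)`: the part of the parametric complexity carried by the data whose maximum
likelihood estimate lies in the Kullback-Leibler ball about `θ₀`. With `g(·, θ)` the
distribution of the estimator under `p_θ`, this is the integral of `g(t, t)` over `t` in the ball:
on the fibre `{y | mle n y = t}` the integrand is `p(y; t)`, and its total over the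
fibre is `g(t, t)`. -/
def ballMass {X : Type*} [MeasurableSpace X] {k : ℕ} (μ : Measure X)
    (q : ℕ → X → Param k → ℝ) (Θ : Set (Param k)) (mle : (n : ℕ) → (Fin n → X) → Param k)
    (n : ℕ) (ε : ℝ) (θ₀ : Param k) : ℝ≥0∞ :=
  ∫⁻ y in {y | mle n y ∈ klBall μ q Θ n ε θ₀}, ENNReal.ofReal (jointDensity q n y (mle n y))
    ∂(Measure.pi fun _ : Fin n => μ)

/-- The finite set `S ⊆ Θ` of representatives satisfies `C_n ≤ ∑_{θ ∈ S} Q_ε(θ)`. -/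
def IsRepresentative {X : Type*} [MeasurableSpace X] {k : ℕ} (μ : Measure X)
    (q : ℕ → X → Param k → ℝ) (Θ : Set (Param k)) (mle : (n : ℕ) → (Fin n → X) → Param k)
    (n : ℕ) (ε : ℝ) (S : Finset (Param k)) : Prop :=
  (S : Set (Param k)) ⊆ Θ ∧ complexity μ q Θ n ≤ ∑ θ ∈ S, ballMass μ q Θ mle n ε θ

/-- `m_n(ε)`: the least cardinality of a representative set (`0` if there is none). -/
def repCount {X : Type*} [MeasurableSpace X] {k : ℕ} (μ : Measure X)
    (q : ℕ → X → Param k → ℝ) (Θ : Set (Param k)) (mle : (n : ℕ) → (Fin n → X) → Param k)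
    (n : ℕ) (ε : ℝ) : ℕ :=
  sInf {m | ∃ S : Finset (Param k), IsRepresentative μ q Θ mle n ε S ∧ S.card = m}

/-- The normalized Fisher information matrix
`I_n(θ) = (1/n) E_θ[-∂² log p(x; θ) / ∂θ ∂θᵀ]`. -/
def fisherInfo {X : Type*} [MeasurableSpace X] {k : ℕ} (μ : Measure X)
    (q : ℕ → X → Param k → ℝ) (n : ℕ) (θ : Param k) : Matrix (Fin k) (Fin k) ℝ :=
  Matrix.of fun a b => (n : ℝ)⁻¹ *
    ∫ y, -(iteratedFDeriv ℝ 2 (fun t => Real.log (jointDensity q n y t)) θ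
      ![EuclideanSpace.single a 1, EuclideanSpace.single b 1]) ∂(dist μ q n θ)

/-- The density at `u` of the centred Gaussian distribution with precision matrix `J`. -/
def gaussianDensity {k : ℕ} (J : Matrix (Fin k) (Fin k) ℝ) (u : Param k) : ℝ :=
  (2 * Real.pi) ^ (-((k : ℝ) / 2)) * Real.sqrt J.det *
    Real.exp (-(u.ofLp ⬝ᵥ J.mulVec u.ofLp) / 2)

/-- `g(·, θ)`: the distribution of the maximum likelihood estimator under `p_θ`. -/
def mleLaw {X : Type*} [MeasurableSpace X] {k : ℕ} (μ : Measure X)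
    (q : ℕ → X → Param k → ℝ) (mle : (n : ℕ) → (Fin n → X) → Param k)
    (n : ℕ) (θ : Param k) : Measure (Param k) :=
  (dist μ q n θ).map (mle n)

/-- Central limit theorem for the maximum likelihood estimator at `θ`: under `p_θ`,
`√n (mle n - θ)` converges in law to the centred Gaussian with precision matrix `J`. -/
def MLECentralLimit {X : Type*} [MeasurableSpace X] {k : ℕ} (μ : Measure X)
    (q : ℕ → X → Param k → ℝ) (mle : (n : ℕ) → (Fin n → X) → Param k)
    (J : Matrix (Fin k) (Fin k) ℝ) (θ : Param k) : Prop :=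
  ∀ f : BoundedContinuousFunction (Param k) ℝ,
    Tendsto (fun n : ℕ => ∫ t, f (Real.sqrt n • (t - θ)) ∂(mleLaw μ q mle n θ)) atTop
      (𝓝 (∫ u, f u * gaussianDensity J u))

end

end DescriptiveDim

/-! Write `C` for the complexity and `M` for the least cardinality of a representative set. Three
one-sided estimates suffice, with constants free of `n` and `ε`: every Kullback-Leibler ball carries
mass at most `A (ε √n)^k`, so `C ≤ M A (ε √n)^k`; some representative set has at most `(D / ε)^k`
elements, so `M ≤ (D / ε)^k`; and `C ≥ a √n^k`. The first is the upper bound for `log C`; the other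
two together give the lower bound, because `M (ε √n)^k ≤ D^k √n^k ≤ (D^k / a) C`.

Mass of a ball (`exists_ballMass_le`). Near each parameter the summed squared Hellinger distance
dominates `n` times the squared Euclidean distance (`exists_local_hellinger`). By compactness `Θ` is
a finite union of pieces where this holds. Divergence dominates Hellinger distance, so a
Kullback-Leibler ball meets each piece in a set of Euclidean diameter `O(ε)`, which is covered by
`O((ε √n)^k)` balls of radius `1 / √n`. Such a small ball carries mass `O(1)`
(`exists_setLIntegral_ball_le`): from the estimate one can move to one of finitely many fixed nearby
points along which the linear term of the log-likelihood does not decrease, so the maximum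
likelihood is at most a sum of finitely many genuine densities times `exp` of `O(1/n)` times the
summed Hessian envelopes, which integrates to a constant.

Few representatives (`exists_isRepresentative`). The divergence of one observation is at most
quadratic in the parameter difference, so Euclidean balls of radius proportional to `ε` lie inside
Kullback-Leibler balls, and a Euclidean covering of `Θ` is representative.

Lower bound (`exists_le_complexity`). On a lattice of mesh `1 / √n` in a small ball inside `Θ` the
affinities decay like a Gaussian in the lattice distance, so the Gram matrix of the square roots of
the densities has bounded row sums. Hence the lattice densities, each of mass one, overlap only
boundedly, and their maximum has mass comparable to the number of lattice points.

All of this rests on exponential moments of the score as well as of the Hessian envelope. The former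
are derived (`exists_exp_envelope_le`): the density at a shifted parameter also has mass one, and it
controls an exponential of the score. -/

namespace DescriptiveDim

/-! ### Densities and product measures -/

theorem lintegral_pi_prod {X : Type*} [MeasurableSpace X] {n : ℕ} (ν : Fin n → Measure X)
    [∀ i, SigmaFinite (ν i)] (f : Fin n → X → ℝ≥0∞) (hf : ∀ i, Measurable (f i)) :
    ∫⁻ y, ∏ i, f i (y i) ∂(Measure.pi ν) = ∏ i, ∫⁻ x, f i x ∂(ν i) := by
  induction n with
  | zero => simp
  | succ n ih =>
    have hm : Measurable fun z : Fin n → X => ∏ i : Fin n, f i.succ (z i) :=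
      Finset.measurable_fun_prod _ fun i _ => (hf i.succ).comp (measurable_pi_apply i)
    calc
      _ = ∫⁻ z : X × (Fin n → X), f 0 z.1 * ∏ i : Fin n, f i.succ (z.2 i)
            ∂((ν 0).prod (Measure.pi fun i => ν i.succ)) := by
        rw [← (measurePreserving_piFinSuccAbove ν 0).symm.lintegral_comp_emb
          (MeasurableEquiv.measurableEmbedding _)]
        simp_rw [MeasurableEquiv.piFinSuccAbove_symm_apply, Fin.insertNthEquiv,
          Fin.prod_univ_succ, Fin.insertNth_zero]
        rfl
      _ = _ := by
        rw [lintegral_prod_mul (hf 0).aemeasurable hm.aemeasurable,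
          ih (fun i => ν i.succ) (fun i => f i.succ) fun i => hf i.succ, Fin.prod_univ_succ]

section Density

variable {Y : Type*} [MeasurableSpace Y] {m : Measure Y} {f g : Y → ℝ}

theorem integral_withDensity_ofReal (hf : Measurable f) (hf0 : ∀ y, 0 ≤ f y) (G : Y → ℝ) :
    ∫ y, G y ∂(m.withDensity fun y => ENNReal.ofReal (f y)) = ∫ y, f y * G y ∂m := by
  rw [integral_withDensity_eq_integral_toReal_smul hf.ennreal_ofReal (by simp)]
  simp [ENNReal.toReal_ofReal (hf0 _)]

theorem integrable_withDensity_ofReal_iff (hf : Measurable f) (hf0 : ∀ y, 0 ≤ f y) (G : Y → ℝ) :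
    Integrable G (m.withDensity fun y => ENNReal.ofReal (f y)) ↔
      Integrable (fun y => f y * G y) m := by
  rw [integrable_withDensity_iff hf.ennreal_ofReal (by simp)]
  simp [ENNReal.toReal_ofReal (hf0 _), mul_comm]

theorem lintegral_withDensity_ofReal (hf : Measurable f) (G : Y → ℝ≥0∞) :
    ∫⁻ y, G y ∂(m.withDensity fun y => ENNReal.ofReal (f y)) =
      ∫⁻ y, ENNReal.ofReal (f y) * G y ∂m :=
  lintegral_withDensity_eq_lintegral_mul_non_measurable _ hf.ennreal_ofReal (by simp) _

theorem isProbabilityMeasure_withDensity (h1 : ∫⁻ y, ENNReal.ofReal (f y) ∂m = 1) :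
    IsProbabilityMeasure (m.withDensity fun y => ENNReal.ofReal (f y)) :=
  ⟨by simpa using h1⟩

/-- The integrand `u - 1 - log u`, with `u = g / f`, is nonnegative, so this form holds in `ℝ≥0∞`
even when the divergence is infinite, and bounds can be proved pointwise. -/
theorem klDiv_withDensity_ofReal [SigmaFinite m] (hf : Measurable f) (hg : Measurable g)
    (hf0 : ∀ y, 0 < f y) (hg0 : ∀ y, 0 < g y) (hf1 : ∫⁻ y, ENNReal.ofReal (f y) ∂m = 1)
    (hg1 : ∫⁻ y, ENNReal.ofReal (g y) ∂m = 1) :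
    InformationTheory.klDiv (m.withDensity fun y => ENNReal.ofReal (f y))
        (m.withDensity fun y => ENNReal.ofReal (g y)) =
      ∫⁻ y, ENNReal.ofReal (g y / f y - 1 - Real.log (g y / f y))
        ∂(m.withDensity fun y => ENNReal.ofReal (f y)) := by
  have := isProbabilityMeasure_withDensity hf1
  have := isProbabilityMeasure_withDensity hg1
  have hfg : m.withDensity (fun y => ENNReal.ofReal (f y)) =
      (m.withDensity fun y => ENNReal.ofReal (g y)).withDensity
        fun y => ENNReal.ofReal (f y / g y) := by
    have hm : Measurable fun y => ENNReal.ofReal (f y / g y) := (hf.div hg).ennreal_ofReal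
    rw [← withDensity_mul _ hg.ennreal_ofReal hm]
    congr 1
    ext y
    rw [Pi.mul_apply, ← ENNReal.ofReal_mul (hg0 y).le, mul_div_cancel₀ _ (hg0 y).ne']
  have hac : m.withDensity (fun y => ENNReal.ofReal (f y)) ≪
      m.withDensity (fun y => ENNReal.ofReal (g y)) := by
    rw [hfg]; exact withDensity_absolutelyContinuous _ _
  rw [InformationTheory.klDiv_eq_lintegral_klFun_of_ac hac]
  have hrn : (m.withDensity fun y => ENNReal.ofReal (f y)).rnDeriv
      (m.withDensity fun y => ENNReal.ofReal (g y))
      =ᵐ[m.withDensity fun y => ENNReal.ofReal (g y)] fun y => ENNReal.ofReal (f y / g y) := by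
    conv_lhs => rw [hfg]
    exact Measure.rnDeriv_withDensity _ (hf.div hg).ennreal_ofReal
  rw [lintegral_congr_ae (g := fun y => ENNReal.ofReal (InformationTheory.klFun (f y / g y))),
    lintegral_withDensity_ofReal hf, lintegral_withDensity_ofReal hg]
  · refine lintegral_congr fun y => ?_
    rw [← ENNReal.ofReal_mul (hg0 y).le, ← ENNReal.ofReal_mul (hf0 y).le,
      InformationTheory.klFun_apply]
    congr 1
    have h1 := (hf0 y).ne'
    have h2 := (hg0 y).ne'
    rw [Real.log_div h1 h2, Real.log_div h2 h1]
    field_simp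
    ring
  · filter_upwards [hrn] with y hy
    rw [hy, ENNReal.toReal_ofReal (div_pos (hf0 y) (hg0 y)).le]

theorem integrable_of_lintegral_ofReal_ne_top (hf : Measurable f) (hf0 : ∀ y, 0 ≤ f y)
    (h1 : ∫⁻ y, ENNReal.ofReal (f y) ∂m ≠ ∞) : Integrable f m :=
  (lintegral_ofReal_ne_top_iff_integrable hf.aestronglyMeasurable (ae_of_all _ hf0)).1 h1

theorem integral_of_lintegral_ofReal_eq_one (hf : Measurable f) (hf0 : ∀ y, 0 ≤ f y)
    (h1 : ∫⁻ y, ENNReal.ofReal (f y) ∂m = 1) : ∫ y, f y ∂m = 1 := by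
  rw [integral_eq_lintegral_of_nonneg_ae (ae_of_all _ hf0) hf.aestronglyMeasurable, h1]
  simp

/-- Lower bound of the Kullback-Leibler divergence by the Hellinger affinity. -/
theorem neg_two_log_affinity_le_klDiv [SigmaFinite m] (hf : Measurable f) (hg : Measurable g)
    (hf0 : ∀ y, 0 < f y) (hg0 : ∀ y, 0 < g y) (hf1 : ∫⁻ y, ENNReal.ofReal (f y) ∂m = 1)
    (hg1 : ∫⁻ y, ENNReal.ofReal (g y) ∂m = 1) {a : ℝ} (ha : 0 < a)
    (hi : Integrable (fun y => √(f y) * √(g y)) m) (hfg : ∫ y, √(f y) * √(g y) ∂m = a) :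
    ENNReal.ofReal (-2 * Real.log a) ≤
      InformationTheory.klDiv (m.withDensity fun y => ENNReal.ofReal (f y))
        (m.withDensity fun y => ENNReal.ofReal (g y)) := by
  have := isProbabilityMeasure_withDensity hf1
  rw [klDiv_withDensity_ofReal hf hg hf0 hg0 hf1 hg1]
  set F : Y → ℝ := fun y => g y / f y - 1 - Real.log (g y / f y) with hF
  have hFm : Measurable F :=
    ((hg.div hf).sub_const 1).sub (Real.measurable_log.comp (hg.div hf))
  have hF0 : ∀ y, 0 ≤ F y := fun y => by
    have := Real.log_le_sub_one_of_pos (div_pos (hg0 y) (hf0 y))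
    simp only [hF]; linarith
  by_cases hfin : ∫⁻ y, ENNReal.ofReal (F y) ∂(m.withDensity fun y => ENNReal.ofReal (f y)) = ∞
  · rw [hfin]; exact le_top
  have hFi := integrable_of_lintegral_ofReal_ne_top hFm hF0 hfin
  rw [← ofReal_integral_eq_lintegral_ofReal hFi (ae_of_all _ hF0)]
  refine ENNReal.ofReal_le_ofReal ?_
  have e1 : ∀ y, f y * (g y / f y) = g y := fun y => mul_div_cancel₀ _ (hf0 y).ne'
  have e2 : ∀ y, f y * (√(g y) / √(f y)) = √(f y) * √(g y) := fun y => by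
    have h1 := (Real.sqrt_pos.2 (hf0 y)).ne'
    have h2 := Real.mul_self_sqrt (hf0 y).le
    rw [mul_div_assoc', div_eq_iff h1, ← h2, Real.sqrt_mul_self (Real.sqrt_nonneg _)]
    ring
  have i1 : Integrable (fun y => g y / f y) (m.withDensity fun y => ENNReal.ofReal (f y)) := by
    rw [integrable_withDensity_ofReal_iff hf fun y => (hf0 y).le]
    simp only [e1]
    exact integrable_of_lintegral_ofReal_ne_top hg (fun y => (hg0 y).le) (by simp [hg1])
  have i2 : Integrable (fun y => √(g y) / √(f y))
      (m.withDensity fun y => ENNReal.ofReal (f y)) := by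
    rw [integrable_withDensity_ofReal_iff hf fun y => (hf0 y).le]
    simpa only [e2] using hi
  have v1 : ∫ y, g y / f y ∂(m.withDensity fun y => ENNReal.ofReal (f y)) = 1 := by
    rw [integral_withDensity_ofReal hf fun y => (hf0 y).le]
    simp only [e1]
    exact integral_of_lintegral_ofReal_eq_one hg (fun y => (hg0 y).le) hg1
  have v2 : ∫ y, √(g y) / √(f y) ∂(m.withDensity fun y => ENNReal.ofReal (f y)) = a := by
    rw [integral_withDensity_ofReal hf fun y => (hf0 y).le]
    simpa only [e2] using hfg
  -- Jensen's inequality by a tangent line: `log u ≤ u - 1` at `u = √(g / f) / a`, normalised so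
  -- that `u` has mean one under `f`. Integrating the left side leaves `-2 log a`.
  have key : ∀ y, g y / f y + (1 - 2 * Real.log a) - 2 / a * (√(g y) / √(f y)) ≤ F y := by
    intro y
    have hpos : 0 < √(g y) / √(f y) := div_pos (Real.sqrt_pos.2 (hg0 y)) (Real.sqrt_pos.2 (hf0 y))
    have hlog : Real.log (g y / f y) = 2 * Real.log (√(g y) / √(f y)) := by
      rw [← Real.sqrt_div (hg0 y).le, Real.log_sqrt (div_pos (hg0 y) (hf0 y)).le]; ring
    have := Real.log_le_sub_one_of_pos (div_pos hpos ha)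
    rw [Real.log_div hpos.ne' ha.ne'] at this
    simp only [hF, hlog]
    have e : 2 / a * (√(g y) / √(f y)) = 2 * (√(g y) / √(f y) / a) := by ring
    linarith
  have := integral_mono ((i1.add (integrable_const _)).sub (i2.const_mul (2 / a))) hFi key
  rw [integral_sub' (i1.add (integrable_const _)) (i2.const_mul _), integral_const_mul, v2] at this
  rw [integral_add' i1 (integrable_const _), v1] at this
  simp only [integral_const, probReal_univ, one_smul] at this
  have e3 : 2 / a * a = 2 := div_mul_cancel₀ _ ha.ne'
  linarith

end Density

/-! ### Taylor estimates with a bounded second derivative -/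

section Taylor

variable {E : Type*} [NormedAddCommGroup E] [NormedSpace ℝ E] {f : E → ℝ} {U s : Set E} {H : ℝ}

theorem differentiableAt_of_contDiffOn_two (hU : IsOpen U) (hf : ContDiffOn ℝ 2 f U) {a : E}
    (ha : a ∈ U) : DifferentiableAt ℝ f a :=
  (hf.contDiffAt (hU.mem_nhds ha)).differentiableAt (by norm_num)

theorem differentiableAt_fderiv_of_contDiffOn_two (hU : IsOpen U) (hf : ContDiffOn ℝ 2 f U) {a : E}
    (ha : a ∈ U) : DifferentiableAt ℝ (fderiv ℝ f) a :=
  ((hf.contDiffAt (hU.mem_nhds ha)).fderiv_right (m := 1) (by norm_num)).differentiableAt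
    (by norm_num)

theorem norm_fderiv_sub_le (hU : IsOpen U) (hf : ContDiffOn ℝ 2 f U)
    (hH : ∀ a ∈ U, ‖fderiv ℝ (fderiv ℝ f) a‖ ≤ H) (hs : Convex ℝ s) (hsU : s ⊆ U) {a b : E}
    (ha : a ∈ s) (hb : b ∈ s) : ‖fderiv ℝ f b - fderiv ℝ f a‖ ≤ H * ‖b - a‖ :=
  hs.norm_image_sub_le_of_norm_fderiv_le
    (fun _ hx => differentiableAt_fderiv_of_contDiffOn_two hU hf (hsU hx))
    (fun x hx => hH x (hsU hx)) ha hb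

/-- Mean value inequality for `f` minus its linear part at `a`, along the segment. The factor `1/2`
of the sharp Taylor bound is given up; only the order matters. -/
theorem abs_sub_sub_fderiv_le (hU : IsOpen U) (hf : ContDiffOn ℝ 2 f U)
    (hH : ∀ a ∈ U, ‖fderiv ℝ (fderiv ℝ f) a‖ ≤ H) (hs : Convex ℝ s) (hsU : s ⊆ U) {a b : E}
    (ha : a ∈ s) (hb : b ∈ s) : |f b - f a - fderiv ℝ f a (b - a)| ≤ H * ‖b - a‖ ^ 2 := by
  have hseg : segment ℝ a b ⊆ s := hs.segment_subset ha hb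
  have hH0 : 0 ≤ H := (norm_nonneg (fderiv ℝ (fderiv ℝ f) a)).trans (hH a (hsU ha))
  have := (convex_segment a b).norm_image_sub_le_of_norm_fderiv_le' (f := f)
    (φ := fderiv ℝ f a) (C := H * ‖b - a‖)
    (fun x hx => differentiableAt_of_contDiffOn_two hU hf (hsU (hseg hx)))
    (fun x hx => (norm_fderiv_sub_le hU hf hH hs hsU ha (hseg hx)).trans
      (mul_le_mul_of_nonneg_left (norm_sub_le_of_mem_segment hx) hH0))
    (left_mem_segment ℝ a b) (right_mem_segment ℝ a b)
  rw [Real.norm_eq_abs] at this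
  calc _ ≤ _ := this
    _ = _ := by ring

end Taylor

/-! ### Measurability of derivatives and elementary exponential inequalities. -/

theorem measurable_fderiv_apply {X : Type*} [MeasurableSpace X] {E : Type*} [NormedAddCommGroup E]
    [NormedSpace ℝ E] {F : X → E → ℝ} {U : Set E} (hU : IsOpen U)
    (hF : ∀ θ ∈ U, Measurable fun x => F x θ) {θ : E} (hθ : θ ∈ U)
    (hd : ∀ x, DifferentiableAt ℝ (F x) θ) (u : E) :
    Measurable fun x => fderiv ℝ (F x) θ u := by
  have hlim : Tendsto (fun n : ℕ => θ + ((n : ℝ))⁻¹ • u) atTop (𝓝 θ) := by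
    have := (tendsto_inv_atTop_nhds_zero_nat (𝕜 := ℝ)).smul_const u
    simpa using this.const_add θ
  -- The derivative is a limit of difference quotients; the shift by `N` keeps every sample point in
  -- `U`, the only place where measurability is known.
  obtain ⟨N, hN⟩ := eventually_atTop.1 (hlim.eventually_mem (hU.mem_nhds hθ))
  refine measurable_of_tendsto_metrizable
    (f := fun (n : ℕ) x => ((n + N : ℕ) : ℝ) • (F x (θ + (((n + N : ℕ) : ℝ))⁻¹ • u) - F x θ))
    (fun n => ((hF _ (hN _ (Nat.le_add_left _ _))).sub (hF θ hθ)).const_mul _) ?_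
  rw [tendsto_pi_nhds]
  intro x
  refine (hd x).hasFDerivAt.lim u ?_
  have h1 : Tendsto (fun n : ℕ => ((n + N : ℕ) : ℝ)) atTop atTop :=
    tendsto_natCast_atTop_atTop.comp (tendsto_add_atTop_nat N)
  exact tendsto_norm_atTop_atTop.comp h1

theorem exp_sub_one_sub_le (x : ℝ) : Real.exp x - 1 - x ≤ x ^ 2 * Real.exp |x| := by
  have h1 : Real.exp x - 1 ≤ x * Real.exp x := by
    have := mul_le_mul_of_nonneg_left (Real.add_one_le_exp (-x)) (Real.exp_pos x).le
    rw [← Real.exp_add, add_neg_cancel, Real.exp_zero] at this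
    linarith
  have h2 := Real.add_one_le_exp x
  rcases le_total 0 x with hx | hx
  · rw [abs_of_nonneg hx]; nlinarith
  · have h3 : 1 ≤ Real.exp |x| := Real.one_le_exp (abs_nonneg x)
    nlinarith [sq_nonneg x]

theorem abs_exp_sub_one_le (x : ℝ) : |Real.exp x - 1| ≤ |x| * Real.exp |x| := by
  have h1 : Real.exp x - 1 ≤ x * Real.exp x := by
    have := mul_le_mul_of_nonneg_left (Real.add_one_le_exp (-x)) (Real.exp_pos x).le
    rw [← Real.exp_add, add_neg_cancel, Real.exp_zero] at this
    linarith
  have h2 := Real.add_one_le_exp x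
  rcases le_total 0 x with hx | hx
  · rw [abs_of_nonneg hx, abs_of_nonneg (by linarith)]; exact h1
  · have h3 : 1 ≤ Real.exp |x| := Real.one_le_exp (abs_nonneg x)
    have h4 : Real.exp x ≤ 1 := Real.exp_le_one_iff.2 hx
    rw [abs_of_nonpos (by linarith), abs_of_nonpos hx]
    rw [abs_of_nonpos hx] at h3
    nlinarith

/-- Half of the exponential moment absorbs any power. The derivative bounds below are all of the
form power times `exp (σ / 2 * x)`, with `x` the envelope. -/
theorem exists_pow_mul_exp_le {σ : ℝ} (hσ : 0 < σ) (p : ℕ) :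
    ∃ K : ℝ, 0 ≤ K ∧ ∀ x : ℝ, 0 ≤ x → x ^ p * Real.exp (σ / 2 * x) ≤ K * Real.exp (σ * x) := by
  refine ⟨p.factorial * (2 / σ) ^ p, by positivity, fun x hx => ?_⟩
  have h1 := Real.pow_div_factorial_le_exp (x := σ / 2 * x) (by positivity) p
  rw [div_le_iff₀ (by positivity)] at h1
  have h2 : x ^ p = (2 / σ) ^ p * (σ / 2 * x) ^ p := by
    rw [← mul_pow]; congr 1; field_simp
  have h3 : Real.exp (σ * x) = Real.exp (σ / 2 * x) * Real.exp (σ / 2 * x) := by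
    rw [← Real.exp_add]; congr 1; ring
  rw [h2, h3]
  calc (2 / σ) ^ p * (σ / 2 * x) ^ p * Real.exp (σ / 2 * x)
      ≤ (2 / σ) ^ p * (Real.exp (σ / 2 * x) * p.factorial) * Real.exp (σ / 2 * x) := by gcongr
    _ = _ := by ring

/-! ### A single observation -/

/-- A family of positive probability densities, log-smooth of order two in the parameter, whose
log-Hessian has an envelope `h` with an exponential moment. -/
structure IsRegularFamily {X : Type*} [MeasurableSpace X] {k : ℕ} (μ : Measure X)
    (U : Set (Param k)) (τ B : ℝ) (h : X → ℝ) (q : X → Param k → ℝ) : Prop where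
  isOpen : IsOpen U
  meas : ∀ θ ∈ U, Measurable fun x => q x θ
  pos : ∀ x, ∀ θ ∈ U, 0 < q x θ
  one : ∀ θ ∈ U, ∫⁻ x, ENNReal.ofReal (q x θ) ∂μ = 1
  smooth : ∀ x, ContDiffOn ℝ 2 (fun θ => Real.log (q x θ)) U
  h_meas : Measurable h
  two : ∀ x, ∀ θ ∈ U, ‖fderiv ℝ (fderiv ℝ fun t => Real.log (q x t)) θ‖ ≤ h x
  exp : ∀ θ ∈ U, ∫⁻ x, ENNReal.ofReal (Real.exp (τ * h x) * q x θ) ∂μ ≤ ENNReal.ofReal B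

/-- The score of one observation. -/
noncomputable def score {X : Type*} {k : ℕ} (q : X → Param k → ℝ) (x : X) (θ : Param k) :
    Param k →L[ℝ] ℝ :=
  fderiv ℝ (fun t => Real.log (q x t)) θ

/-- A bound of the derivatives of order one and two of the log-density. -/
noncomputable def envelope {X : Type*} {k : ℕ} (q : X → Param k → ℝ) (h : X → ℝ) (θ : Param k)
    (x : X) : ℝ :=
  ∑ j, |score q x θ (EuclideanSpace.single j 1)| + h x

theorem norm_le_sum_abs_apply_single {k : ℕ} (L : Param k →L[ℝ] ℝ) :
    ‖L‖ ≤ ∑ j, |L (EuclideanSpace.single j 1)| := by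
  refine L.opNorm_le_bound (Finset.sum_nonneg fun _ _ => abs_nonneg _) fun u => ?_
  have hu : u = ∑ j, u j • EuclideanSpace.single j (1 : ℝ) := by
    ext i
    simp [Finset.sum_apply, Pi.single_apply]
  conv_lhs => rw [hu, map_sum]
  rw [Real.norm_eq_abs, Finset.sum_mul]
  refine (Finset.abs_sum_le_sum_abs _ _).trans (Finset.sum_le_sum fun j _ => ?_)
  rw [map_smul, smul_eq_mul, abs_mul, mul_comm]
  exact mul_le_mul_of_nonneg_left (by simpa using PiLp.norm_apply_le u j) (abs_nonneg _)

theorem h_le_envelope {X : Type*} {k : ℕ} (q : X → Param k → ℝ) (h : X → ℝ) (θ : Param k)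
    (x : X) : h x ≤ envelope q h θ x :=
  le_add_of_nonneg_left (Finset.sum_nonneg fun _ _ => abs_nonneg _)

theorem norm_score_add_le_envelope {X : Type*} {k : ℕ} (q : X → Param k → ℝ)
    (h : X → ℝ) (θ : Param k) (x : X) :
    ‖score q x θ‖ + h x ≤ envelope q h θ x :=
  add_le_add (norm_le_sum_abs_apply_single _) le_rfl

namespace IsRegularFamily

variable {X : Type*} [MeasurableSpace X] {k : ℕ} {μ : Measure X} {U : Set (Param k)} {τ B : ℝ}
  {h : X → ℝ} {q : X → Param k → ℝ} {θ : Param k}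

theorem h_nonneg (hq : IsRegularFamily μ U τ B h q) (hθ : θ ∈ U) (x : X) : 0 ≤ h x :=
  (norm_nonneg (fderiv ℝ (fderiv ℝ fun t => Real.log (q x t)) θ)).trans (hq.two x θ hθ)

theorem envelope_nonneg (hq : IsRegularFamily μ U τ B h q) (hθ : θ ∈ U) (x : X) :
    0 ≤ envelope q h θ x :=
  add_nonneg (Finset.sum_nonneg fun _ _ => abs_nonneg _) (hq.h_nonneg hθ x)

theorem norm_score_le_envelope (hq : IsRegularFamily μ U τ B h q) (hθ : θ ∈ U) (x : X) :
    ‖score q x θ‖ ≤ envelope q h θ x :=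
  (norm_le_sum_abs_apply_single _).trans (le_add_of_nonneg_right (hq.h_nonneg hθ x))

theorem measurable_log (hq : IsRegularFamily μ U τ B h q) (hθ : θ ∈ U) :
    Measurable fun x => Real.log (q x θ) :=
  Real.measurable_log.comp (hq.meas θ hθ)

theorem differentiableAt (hq : IsRegularFamily μ U τ B h q) (hθ : θ ∈ U) (x : X) :
    DifferentiableAt ℝ (fun t => Real.log (q x t)) θ :=
  differentiableAt_of_contDiffOn_two hq.isOpen (hq.smooth x) hθ

theorem differentiableAt_score (hq : IsRegularFamily μ U τ B h q) (hθ : θ ∈ U) (x : X) :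
    DifferentiableAt ℝ (score q x) θ :=
  differentiableAt_fderiv_of_contDiffOn_two hq.isOpen (hq.smooth x) hθ

theorem measurable_score (hq : IsRegularFamily μ U τ B h q) (hθ : θ ∈ U) (u : Param k) :
    Measurable fun x => score q x θ u :=
  measurable_fderiv_apply hq.isOpen (fun _ ha => hq.measurable_log ha) hθ
    (hq.differentiableAt hθ) u

theorem measurable_hessian (hq : IsRegularFamily μ U τ B h q) (hθ : θ ∈ U) (u v : Param k) :
    Measurable fun x => fderiv ℝ (score q x) θ u v := by
  have hd : ∀ x, HasFDerivAt (fun t => score q x t v)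
      ((ContinuousLinearMap.apply ℝ ℝ v).comp (fderiv ℝ (score q x) θ)) θ := fun x =>
    (ContinuousLinearMap.apply ℝ ℝ v).hasFDerivAt.comp θ (hq.differentiableAt_score hθ x).hasFDerivAt
  have := measurable_fderiv_apply (F := fun x t => score q x t v) hq.isOpen
    (fun _ ha => hq.measurable_score ha v) hθ (fun x => (hd x).differentiableAt) u
  simpa only [(hd _).fderiv] using! this

theorem measurable_envelope (hq : IsRegularFamily μ U τ B h q) (hθ : θ ∈ U) :
    Measurable (envelope q h θ) :=
  (Finset.measurable_fun_sum _ fun _ _ => (hq.measurable_score hθ _).abs).add hq.h_meas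

variable {s : Set (Param k)} {a b : Param k}

theorem abs_log_sub_sub_score_le (hq : IsRegularFamily μ U τ B h q) (hs : Convex ℝ s)
    (hsU : s ⊆ U) (ha : a ∈ s) (hb : b ∈ s) (x : X) :
    |Real.log (q x b) - Real.log (q x a) - score q x a (b - a)| ≤ h x * ‖b - a‖ ^ 2 :=
  abs_sub_sub_fderiv_le hq.isOpen (hq.smooth x) (hq.two x) hs hsU ha hb

theorem norm_score_sub_le (hq : IsRegularFamily μ U τ B h q) (hs : Convex ℝ s)
    (hsU : s ⊆ U) (ha : a ∈ s) (hb : b ∈ s) (x : X) :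
    ‖score q x b - score q x a‖ ≤ h x * ‖b - a‖ :=
  norm_fderiv_sub_le hq.isOpen (hq.smooth x) (hq.two x) hs hsU ha hb

/-- For `‖b - a‖ ≤ 1` the quadratic remainder is at most linear, so score and Hessian bound add up
to the envelope. -/
theorem abs_log_sub_le (hq : IsRegularFamily μ U τ B h q) (hs : Convex ℝ s)
    (hsU : s ⊆ U) (ha : a ∈ s) (hb : b ∈ s) (hab : ‖b - a‖ ≤ 1) (x : X) :
    |Real.log (q x b) - Real.log (q x a)| ≤ ‖b - a‖ * envelope q h a x := by
  have h1 := hq.abs_log_sub_sub_score_le hs hsU ha hb x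
  have h2 : |score q x a (b - a)| ≤ ‖score q x a‖ * ‖b - a‖ := (score q x a).le_opNorm _
  have h3 := norm_score_add_le_envelope q h a x
  have h0 := hq.h_nonneg (hsU ha) x
  have h4 : h x * ‖b - a‖ ^ 2 ≤ h x * ‖b - a‖ := by
    refine mul_le_mul_of_nonneg_left ?_ h0
    nlinarith [norm_nonneg (b - a)]
  have h5 := mul_le_mul_of_nonneg_left h3 (norm_nonneg (b - a))
  rw [abs_le] at *
  constructor <;> linarith

end IsRegularFamily

/-! ### Exponential moments of the score and the quadratic bound for the divergence. -/

namespace IsRegularFamily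

variable {X : Type*} [MeasurableSpace X] {k : ℕ} {μ : Measure X} {U : Set (Param k)} {τ B : ℝ}
  {h : X → ℝ} {q : X → Param k → ℝ} {θ : Param k}

theorem integrable (hq : IsRegularFamily μ U τ B h q) (hθ : θ ∈ U) :
    Integrable (fun x => q x θ) μ :=
  integrable_of_lintegral_ofReal_ne_top (hq.meas θ hθ) (fun x => (hq.pos x θ hθ).le)
    (by simp [hq.one θ hθ])

theorem integral_eq_one (hq : IsRegularFamily μ U τ B h q) (hθ : θ ∈ U) :
    ∫ x, q x θ ∂μ = 1 :=
  integral_of_lintegral_ofReal_eq_one (hq.meas θ hθ) (fun x => (hq.pos x θ hθ).le) (hq.one θ hθ)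

theorem integrable_exp_mul (hq : IsRegularFamily μ U τ B h q) (hθ : θ ∈ U) :
    Integrable (fun x => Real.exp (τ * h x) * q x θ) μ ∧
      ∫ x, Real.exp (τ * h x) * q x θ ∂μ ≤ |B| := by
  have hm : Measurable fun x => Real.exp (τ * h x) * q x θ :=
    (Real.measurable_exp.comp (hq.h_meas.const_mul τ)).mul (hq.meas θ hθ)
  have h0 : ∀ x, 0 ≤ Real.exp (τ * h x) * q x θ := fun x =>
    mul_nonneg (Real.exp_pos _).le (hq.pos x θ hθ).le
  refine ⟨integrable_of_lintegral_ofReal_ne_top hm h0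
    ((hq.exp θ hθ).trans_lt ENNReal.ofReal_lt_top).ne, ?_⟩
  rw [integral_eq_lintegral_of_nonneg_ae (ae_of_all _ h0) hm.aestronglyMeasurable]
  refine ENNReal.toReal_le_of_le_ofReal (abs_nonneg B) ?_
  exact (hq.exp θ hθ).trans (ENNReal.ofReal_le_ofReal (le_abs_self B))

/-- By Taylor, `q x (θ + v • e)` is at least `q x θ * exp (v * score - v ^ 2 * h)`. If half of the
linear term beats `τ * h`, it also beats the error since `v ^ 2 ≤ τ`, and the shifted density
dominates; otherwise the envelope term does. Both terms on the right have controlled integrals. -/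
theorem exp_half_score_mul_le (hq : IsRegularFamily μ U τ B h q) {v : ℝ} (hv0 : 0 ≤ v)
    (hv : Metric.closedBall θ v ⊆ U) (hvτ : v ^ 2 ≤ τ) {e : Param k} (he : ‖e‖ = 1) (x : X) :
    Real.exp (v / 2 * score q x θ e) * q x θ ≤
      q x (θ + v • e) + Real.exp (τ * h x) * q x θ := by
  have hθ : θ ∈ Metric.closedBall θ v := Metric.mem_closedBall_self hv0
  have hn : ‖θ + v • e - θ‖ = v := by
    rw [add_sub_cancel_left, norm_smul, he, mul_one, Real.norm_of_nonneg hv0]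
  have hb : θ + v • e ∈ Metric.closedBall θ v := mem_closedBall_iff_norm.2 hn.le
  have h1 := (abs_le.1 (hq.abs_log_sub_sub_score_le (convex_closedBall θ v) hv hθ hb x)).1
  rw [hn, add_sub_cancel_left, map_smul, smul_eq_mul] at h1
  have hp := hq.pos x θ (hv hθ)
  have hp' := hq.pos x _ (hv hb)
  have h0 := hq.h_nonneg (hv hθ) x
  have h2 : Real.exp (v * score q x θ e - h x * v ^ 2) * q x θ ≤ q x (θ + v • e) := by
    calc _ = Real.exp (v * score q x θ e - h x * v ^ 2 + Real.log (q x θ)) := by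
          rw [Real.exp_add, Real.exp_log hp]
      _ ≤ Real.exp (Real.log (q x (θ + v • e))) := Real.exp_le_exp.2 (by linarith)
      _ = _ := Real.exp_log hp'
  rcases le_total (v / 2 * score q x θ e) (τ * h x) with hc | hc
  · have := mul_le_mul_of_nonneg_right (Real.exp_le_exp.2 hc) hp.le
    linarith
  · have h3 : h x * v ^ 2 ≤ τ * h x := by nlinarith
    have h4 : v / 2 * score q x θ e ≤ v * score q x θ e - h x * v ^ 2 := by linarith
    have h5 := mul_le_mul_of_nonneg_right (Real.exp_le_exp.2 h4) hp.le
    have h6 := mul_pos (Real.exp_pos (τ * h x)) hp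
    linarith

/-- The envelope of the derivatives has an exponential moment, with constants which depend only
on the constants of the family. -/
theorem exists_exp_envelope_le {δ : ℝ} (hδ : 0 < δ) (hτ : 0 < τ) :
    ∃ σ > 0, ∃ C : ℝ, 0 ≤ C ∧ ∀ h q, IsRegularFamily μ U τ B h q → ∀ θ,
      Metric.closedBall θ δ ⊆ U →
        Integrable (fun x => q x θ * Real.exp (σ * envelope q h θ x)) μ ∧
          ∫ x, q x θ * Real.exp (σ * envelope q h θ x) ∂μ ≤ C := by
  obtain ⟨v, hv, hvδ, hvτ⟩ : ∃ v > 0, v ≤ δ ∧ v ^ 2 ≤ τ := by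
    refine ⟨min δ (min 1 τ), by positivity, min_le_left _ _, ?_⟩
    have h1 : min δ (min 1 τ) ≤ 1 := (min_le_right _ _).trans (min_le_left _ _)
    have h2 : min δ (min 1 τ) ≤ τ := (min_le_right _ _).trans (min_le_right _ _)
    have h3 : 0 < min δ (min 1 τ) := by positivity
    nlinarith
  set s : ℝ := min (v / 2) τ with hs
  have hs0 : 0 < s := by positivity
  refine ⟨s / (k + 1), by positivity, k * (2 + 2 * |B|) + |B|, by positivity, ?_⟩
  intro h q hq θ hθδ
  have hvU : Metric.closedBall θ v ⊆ U := (Metric.closedBall_subset_closedBall hvδ).trans hθδ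
  have hθ : θ ∈ U := hvU (Metric.mem_closedBall_self hv.le)
  let e : Fin k → Param k := fun j => EuclideanSpace.single j (1 : ℝ)
  have he : ∀ j, ‖e j‖ = 1 := fun j => by simp [e]
  have hmem : ∀ j, θ + v • e j ∈ U ∧ θ + v • -e j ∈ U := fun j =>
    ⟨hvU (mem_closedBall_iff_norm.2 (by
      rw [add_sub_cancel_left, norm_smul, he, mul_one, Real.norm_of_nonneg hv.le])),
    hvU (mem_closedBall_iff_norm.2 (by
      rw [add_sub_cancel_left, norm_smul, norm_neg, he, mul_one, Real.norm_of_nonneg hv.le]))⟩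
  -- The dominating function: for each coordinate the bounds for both signs of the score, plus the
  -- case in which `h` dominates.
  set R : X → ℝ := fun x => ∑ j, (q x (θ + v • e j) + q x (θ + v • -e j) +
    2 * (Real.exp (τ * h x) * q x θ)) + Real.exp (τ * h x) * q x θ with hR
  have hE := hq.integrable_exp_mul hθ
  have hji : ∀ j, Integrable (fun x => q x (θ + v • e j) + q x (θ + v • -e j) +
      2 * (Real.exp (τ * h x) * q x θ)) μ := fun j =>
    ((hq.integrable (hmem j).1).add (hq.integrable (hmem j).2)).add (hE.1.const_mul 2)
  have hRi : Integrable R μ := (integrable_finsetSum _ fun j _ => hji j).add hE.1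
  have hRint : ∫ x, R x ∂μ ≤ k * (2 + 2 * |B|) + |B| := by
    rw [hR, integral_add (integrable_finsetSum _ fun j _ => hji j) hE.1,
      integral_finsetSum _ fun j _ => hji j]
    have hj : ∀ j ∈ Finset.univ, ∫ x, (q x (θ + v • e j) + q x (θ + v • -e j) +
        2 * (Real.exp (τ * h x) * q x θ)) ∂μ ≤ 2 + 2 * |B| := fun j _ => by
      have hab : Integrable (fun x => q x (θ + v • e j) + q x (θ + v • -e j)) μ :=
        (hq.integrable (hmem j).1).add (hq.integrable (hmem j).2)
      rw [integral_add hab (hE.1.const_mul 2), integral_add (hq.integrable (hmem j).1) (hq.integrable (hmem j).2),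
        hq.integral_eq_one (hmem j).1, hq.integral_eq_one (hmem j).2, integral_const_mul]
      linarith [hE.2]
    have := Finset.sum_le_card_nsmul _ _ _ hj
    simp only [Finset.card_univ, Fintype.card_fin, nsmul_eq_mul] at this
    linarith [hE.2]
  have hle : ∀ x, q x θ * Real.exp (s / (k + 1) * envelope q h θ x) ≤ R x := by
    intro x
    have hp := hq.pos x θ hθ
    have hh := hq.h_nonneg hθ x
    have hEp : 0 < Real.exp (τ * h x) * q x θ := mul_pos (Real.exp_pos _) hp
    have hterm : ∀ j, 0 ≤ q x (θ + v • e j) + q x (θ + v • -e j) +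
        2 * (Real.exp (τ * h x) * q x θ) := fun j => by
      have h1 := hq.pos x _ (hmem j).1
      have h2 := hq.pos x _ (hmem j).2
      positivity
    set t := s / (k + 1) * envelope q h θ x with ht
    -- The envelope has `k + 1` summands and `t` is `s` times their average, so one summand times
    -- `s` is at least `t`.
    by_cases hc : ∃ j, t ≤ s * |score q x θ (e j)|
    · obtain ⟨j, hj⟩ := hc
      have h1 := hq.exp_half_score_mul_le hv.le hvU hvτ (he j) x
      have h2 := hq.exp_half_score_mul_le hv.le hvU hvτ (e := -e j) (by simp [he]) x
      have h3 : t ≤ v / 2 * |score q x θ (e j)| :=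
        hj.trans (mul_le_mul_of_nonneg_right (min_le_left _ _) (abs_nonneg _))
      have h4 : Real.exp t * q x θ ≤ q x (θ + v • e j) + q x (θ + v • -e j) +
          2 * (Real.exp (τ * h x) * q x θ) := by
        have p1 := hq.pos x _ (hmem j).1
        have p2 := hq.pos x _ (hmem j).2
        rcases abs_cases (score q x θ (e j)) with ⟨ha, _⟩ | ⟨ha, _⟩
        · rw [ha] at h3
          have := mul_le_mul_of_nonneg_right (Real.exp_le_exp.2 h3) hp.le
          linarith
        · rw [ha] at h3
          rw [map_neg] at h2
          have := mul_le_mul_of_nonneg_right (Real.exp_le_exp.2 h3) hp.le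
          linarith
      have h5 := Finset.single_le_sum (fun j _ => hterm j) (Finset.mem_univ j)
      simp only [hR]
      rw [mul_comm]
      linarith
    · push Not at hc
      have h1 : t ≤ s * h x := by
        by_contra hlt
        push Not at hlt
        have h2 : ∑ j : Fin k, s * |score q x θ (e j)| ≤ k * t := by
          have := Finset.sum_le_card_nsmul Finset.univ _ t fun j _ => (hc j).le
          simpa using this
        rw [← Finset.mul_sum] at h2
        have h3 : (k + 1) * t = s * envelope q h θ x := by rw [ht]; field_simp
        rw [envelope, mul_add] at h3
        linarith
      have h2 : t ≤ τ * h x := h1.trans (mul_le_mul_of_nonneg_right (min_le_right _ _) hh)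
      have h3 := mul_le_mul_of_nonneg_right (Real.exp_le_exp.2 h2) hp.le
      have h4 := Finset.sum_nonneg fun j (_ : j ∈ Finset.univ) => hterm j
      simp only [hR]
      rw [mul_comm]
      linarith
  have hnn : ∀ x, 0 ≤ q x θ * Real.exp (s / (k + 1) * envelope q h θ x) := fun x =>
    mul_nonneg (hq.pos x θ hθ).le (Real.exp_pos _).le
  have hm : Measurable fun x => q x θ * Real.exp (s / (k + 1) * envelope q h θ x) :=
    (hq.meas θ hθ).mul (Real.measurable_exp.comp ((hq.measurable_envelope hθ).const_mul _))
  have hint : Integrable (fun x => q x θ * Real.exp (s / (k + 1) * envelope q h θ x)) μ :=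
    hRi.mono' hm.aestronglyMeasurable (ae_of_all _ fun x => by
      rw [Real.norm_of_nonneg (hnn x)]; exact hle x)
  exact ⟨hint, (integral_mono hint hRi hle).trans hRint⟩

variable {σ C : ℝ}

theorem integrable_mul_of_abs_le (hq : IsRegularFamily μ U τ B h q) (hθ : θ ∈ U)
    (hi : Integrable (fun x => q x θ * Real.exp (σ * envelope q h θ x)) μ) {K : ℝ}
    {G : X → ℝ} (hG : Measurable G) (hK : ∀ x, |G x| ≤ K * Real.exp (σ * envelope q h θ x)) :
    Integrable (fun x => q x θ * G x) μ := by
  refine (hi.const_mul K).mono' ((hq.meas θ hθ).mul hG).aestronglyMeasurable (ae_of_all _ ?_)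
  intro x
  rw [Real.norm_eq_abs, abs_mul, abs_of_pos (hq.pos x θ hθ)]
  calc _ ≤ q x θ * (K * Real.exp (σ * envelope q h θ x)) :=
        mul_le_mul_of_nonneg_left (hK x) (hq.pos x θ hθ).le
    _ = _ := by ring

theorem integral_mul_le_of_le (hq : IsRegularFamily μ U τ B h q) (hθ : θ ∈ U)
    (hi : Integrable (fun x => q x θ * Real.exp (σ * envelope q h θ x)) μ)
    (hC : ∫ x, q x θ * Real.exp (σ * envelope q h θ x) ∂μ ≤ C) {K : ℝ} (hK0 : 0 ≤ K)
    {G : X → ℝ} (hGi : Integrable (fun x => q x θ * G x) μ)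
    (hK : ∀ x, G x ≤ K * Real.exp (σ * envelope q h θ x)) :
    ∫ x, q x θ * G x ∂μ ≤ K * C := by
  calc _ ≤ ∫ x, K * (q x θ * Real.exp (σ * envelope q h θ x)) ∂μ := by
        refine integral_mono hGi (hi.const_mul K) fun x => ?_
        calc _ ≤ q x θ * (K * Real.exp (σ * envelope q h θ x)) :=
              mul_le_mul_of_nonneg_left (hK x) (hq.pos x θ hθ).le
          _ = _ := by ring
    _ ≤ _ := by rw [integral_const_mul]; exact mul_le_mul_of_nonneg_left hC hK0

/-- The Kullback-Leibler divergence of one observation is at most quadratic. -/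
theorem exists_integral_log_sub_le {δ : ℝ} (hδ : 0 < δ) (hτ : 0 < τ) :
    ∃ η > 0, ∃ A : ℝ, 0 ≤ A ∧ ∀ h q, IsRegularFamily μ U τ B h q → ∀ θ,
      Metric.closedBall θ δ ⊆ U → ∀ θ', ‖θ' - θ‖ ≤ η → θ' ∈ U ∧
        Integrable (fun x => q x θ * (Real.log (q x θ) - Real.log (q x θ'))) μ ∧
          ∫ x, q x θ * (Real.log (q x θ) - Real.log (q x θ')) ∂μ ≤ A * ‖θ' - θ‖ ^ 2 := by
  obtain ⟨σ, hσ, C, hC0, hC⟩ := exists_exp_envelope_le (μ := μ) (U := U) (B := B) hδ hτ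
  obtain ⟨K, hK0, hK⟩ := exists_pow_mul_exp_le hσ 2
  obtain ⟨K₁, hK₁0, hK₁⟩ := exists_pow_mul_exp_le hσ 1
  -- `δ` keeps `θ'` in `U`, `1` permits the linear bound of the log-ratio, and `σ / 2` leaves half
  -- of the exponential moment for the factor squared.
  refine ⟨min δ (min 1 (σ / 2)), by positivity, K * C, by positivity, ?_⟩
  intro h q hq θ hθδ θ' hθ'
  obtain ⟨hi, hiC⟩ := hC h q hq θ hθδ
  have hη1 : ‖θ' - θ‖ ≤ 1 := hθ'.trans ((min_le_right _ _).trans (min_le_left _ _))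
  have hησ : ‖θ' - θ‖ ≤ σ / 2 := hθ'.trans ((min_le_right _ _).trans (min_le_right _ _))
  have hmem : θ ∈ Metric.closedBall θ δ := Metric.mem_closedBall_self hδ.le
  have hmem' : θ' ∈ Metric.closedBall θ δ := mem_closedBall_iff_norm.2 (hθ'.trans (min_le_left _ _))
  have hθ := hθδ hmem
  have hθU' := hθδ hmem'
  have hL : ∀ x, |Real.log (q x θ') - Real.log (q x θ)| ≤ ‖θ' - θ‖ * envelope q h θ x := fun x =>
    hq.abs_log_sub_le (convex_closedBall θ δ) hθδ hmem hmem' hη1 x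
  have hM0 := fun x => hq.envelope_nonneg hθ x
  have hLm : Measurable fun x => Real.log (q x θ) - Real.log (q x θ') :=
    (hq.measurable_log hθ).sub (hq.measurable_log hθU')
  have hLi : Integrable (fun x => q x θ * (Real.log (q x θ) - Real.log (q x θ'))) μ := by
    refine hq.integrable_mul_of_abs_le hθ hi hLm (K := K₁) fun x => ?_
    rw [abs_sub_comm]
    have h2 : 1 ≤ Real.exp (σ / 2 * envelope q h θ x) :=
      Real.one_le_exp (mul_nonneg (by positivity) (hM0 x))
    have h3 := hK₁ _ (hM0 x)
    have h4 := hM0 x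
    have h5 := hL x
    rw [pow_one] at h3
    nlinarith
  refine ⟨hθU', hLi, ?_⟩
  -- Adding `q x θ' - q x θ`, of integral zero, cancels the first-order term: `exp L - 1 - L` is
  -- quadratic in the log-ratio `L`.
  set G : X → ℝ := fun x => Real.exp (Real.log (q x θ') - Real.log (q x θ)) - 1 -
    (Real.log (q x θ') - Real.log (q x θ)) with hG
  have hqG : ∀ x, q x θ * G x =
      q x θ' - q x θ + q x θ * (Real.log (q x θ) - Real.log (q x θ')) := fun x => by
    simp only [hG]
    rw [Real.exp_sub, Real.exp_log (hq.pos x θ' hθU'), Real.exp_log (hq.pos x θ hθ)]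
    have := (hq.pos x θ hθ).ne'
    field_simp
    ring
  have hGi : Integrable (fun x => q x θ * G x) μ := by
    simp only [hqG]
    exact ((hq.integrable hθU').sub (hq.integrable hθ)).add hLi
  have hGint : ∫ x, q x θ * G x ∂μ =
      ∫ x, q x θ * (Real.log (q x θ) - Real.log (q x θ')) ∂μ := by
    simp only [hqG]
    have hab : Integrable (fun x => q x θ' - q x θ) μ := (hq.integrable hθU').sub (hq.integrable hθ)
    rw [integral_add hab hLi,
      integral_sub (hq.integrable hθU') (hq.integrable hθ), hq.integral_eq_one hθ,
      hq.integral_eq_one hθU']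
    ring
  rw [← hGint]
  have := hq.integral_mul_le_of_le hθ hi hiC (K := K * ‖θ' - θ‖ ^ 2) (by positivity) hGi
    fun x => ?_
  · linarith
  · calc G x ≤ |Real.log (q x θ') - Real.log (q x θ)| ^ 2 *
          Real.exp |Real.log (q x θ') - Real.log (q x θ)| := by
          rw [sq_abs]; exact exp_sub_one_sub_le _
      _ ≤ (‖θ' - θ‖ * envelope q h θ x) ^ 2 * Real.exp (σ / 2 * envelope q h θ x) := by
          have h1 := hL x
          have h2 : ‖θ' - θ‖ * envelope q h θ x ≤ σ / 2 * envelope q h θ x :=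
            mul_le_mul_of_nonneg_right hησ (hM0 x)
          gcongr
          exact h1.trans h2
      _ = ‖θ' - θ‖ ^ 2 * (envelope q h θ x ^ 2 * Real.exp (σ / 2 * envelope q h θ x)) := by ring
      _ ≤ ‖θ' - θ‖ ^ 2 * (K * Real.exp (σ * envelope q h θ x)) := by
          exact mul_le_mul_of_nonneg_left (hK _ (hM0 x)) (by positivity)
      _ = _ := by ring

end IsRegularFamily

/-! ### Hellinger affinity, the information identity and the local lower bound. -/

/-- The Hellinger affinity `∫ √(q_a q_b)` of two members of the family. -/
noncomputable def affinity {X : Type*} [MeasurableSpace X] {k : ℕ} (μ : Measure X)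
    (q : X → Param k → ℝ) (a b : Param k) : ℝ :=
  ∫ x, √(q x a) * √(q x b) ∂μ

namespace IsRegularFamily

variable {X : Type*} [MeasurableSpace X] {k : ℕ} {μ : Measure X} {U : Set (Param k)} {τ B : ℝ}
  {h : X → ℝ} {q : X → Param k → ℝ} {θ a b c : Param k} {σ C : ℝ}

theorem measurable_sqrt_mul_sqrt (hq : IsRegularFamily μ U τ B h q) (ha : a ∈ U) (hb : b ∈ U) :
    Measurable fun x => √(q x a) * √(q x b) :=
  (hq.meas a ha).sqrt.mul (hq.meas b hb).sqrt

theorem integrable_sqrt_mul_sqrt (hq : IsRegularFamily μ U τ B h q) (ha : a ∈ U) (hb : b ∈ U) :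
    Integrable (fun x => √(q x a) * √(q x b)) μ := by
  refine ((hq.integrable ha).add (hq.integrable hb)).mono'
    (hq.measurable_sqrt_mul_sqrt ha hb).aestronglyMeasurable (ae_of_all _ fun x => ?_)
  have h1 := Real.sq_sqrt (hq.pos x a ha).le
  have h2 := Real.sq_sqrt (hq.pos x b hb).le
  have h3 := Real.sqrt_nonneg (q x a)
  have h4 := Real.sqrt_nonneg (q x b)
  rw [Real.norm_of_nonneg (by positivity), Pi.add_apply]
  nlinarith [sq_nonneg (√(q x a) - √(q x b))]

theorem sqrt_sub_sqrt_sq (hq : IsRegularFamily μ U τ B h q) (ha : a ∈ U) (hb : b ∈ U) (x : X) :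
    (√(q x a) - √(q x b)) ^ 2 = q x a + q x b - 2 * (√(q x a) * √(q x b)) := by
  have h1 := Real.sq_sqrt (hq.pos x a ha).le
  have h2 := Real.sq_sqrt (hq.pos x b hb).le
  linear_combination h1 + h2

theorem integrable_sqrt_sub_sqrt_sq (hq : IsRegularFamily μ U τ B h q) (ha : a ∈ U)
    (hb : b ∈ U) : Integrable (fun x => (√(q x a) - √(q x b)) ^ 2) μ := by
  simp only [hq.sqrt_sub_sqrt_sq ha hb]
  exact ((hq.integrable ha).add (hq.integrable hb)).sub
    ((hq.integrable_sqrt_mul_sqrt ha hb).const_mul 2)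

theorem integral_sqrt_sub_sqrt_sq (hq : IsRegularFamily μ U τ B h q) (ha : a ∈ U) (hb : b ∈ U) :
    ∫ x, (√(q x a) - √(q x b)) ^ 2 ∂μ = 2 * (1 - affinity μ q a b) := by
  simp only [hq.sqrt_sub_sqrt_sq ha hb]
  have hab : Integrable (fun x => q x a + q x b) μ := (hq.integrable ha).add (hq.integrable hb)
  rw [integral_sub hab ((hq.integrable_sqrt_mul_sqrt ha hb).const_mul 2),
    integral_add (hq.integrable ha) (hq.integrable hb), hq.integral_eq_one ha,
    hq.integral_eq_one hb, integral_const_mul, affinity]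
  ring

theorem affinity_pos (hq : IsRegularFamily μ U τ B h q) (ha : a ∈ U) (hb : b ∈ U) :
    0 < affinity μ q a b := by
  have hpos : ∀ x, 0 < √(q x a) * √(q x b) := fun x =>
    mul_pos (Real.sqrt_pos.2 (hq.pos x a ha)) (Real.sqrt_pos.2 (hq.pos x b hb))
  rw [affinity, integral_pos_iff_support_of_nonneg (fun x => (hpos x).le)
    (hq.integrable_sqrt_mul_sqrt ha hb)]
  have : (Function.support fun x => √(q x a) * √(q x b)) = Set.univ :=
    Set.eq_univ_of_forall fun x => (hpos x).ne'
  rw [this, pos_iff_ne_zero, ne_eq, Measure.measure_univ_eq_zero]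
  rintro rfl
  simpa using hq.one a ha

/-- The relaxed triangle inequality `(x - y)² ≤ 2 (z - x)² + 2 (z - y)²`, integrated for the square
roots of the densities. -/
theorem one_sub_affinity_le (hq : IsRegularFamily μ U τ B h q) (ha : a ∈ U) (hb : b ∈ U)
    (hc : c ∈ U) :
    1 - affinity μ q a b ≤ 2 * (1 - affinity μ q c a) + 2 * (1 - affinity μ q c b) := by
  have h1 : ∫ x, (√(q x a) - √(q x b)) ^ 2 ∂μ ≤
      ∫ x, (2 * (√(q x c) - √(q x a)) ^ 2 + 2 * (√(q x c) - √(q x b)) ^ 2) ∂μ :=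
    integral_mono (hq.integrable_sqrt_sub_sqrt_sq ha hb)
      (((hq.integrable_sqrt_sub_sqrt_sq hc ha).const_mul 2).add
        ((hq.integrable_sqrt_sub_sqrt_sq hc hb).const_mul 2)) fun x => by
      show (√(q x a) - √(q x b)) ^ 2 ≤
        2 * (√(q x c) - √(q x a)) ^ 2 + 2 * (√(q x c) - √(q x b)) ^ 2
      nlinarith [sq_nonneg ((√(q x c) - √(q x a)) + (√(q x c) - √(q x b)))]
  rw [integral_add ((hq.integrable_sqrt_sub_sqrt_sq hc ha).const_mul 2)
    ((hq.integrable_sqrt_sub_sqrt_sq hc hb).const_mul 2), integral_const_mul, integral_const_mul,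
    hq.integral_sqrt_sub_sqrt_sq ha hb, hq.integral_sqrt_sub_sqrt_sq hc ha,
    hq.integral_sqrt_sub_sqrt_sq hc hb] at h1
  linarith

theorem integrable_score_sq (hq : IsRegularFamily μ U τ B h q) (hθ : θ ∈ U) (hσ : 0 < σ)
    (hi : Integrable (fun x => q x θ * Real.exp (σ * envelope q h θ x)) μ) (u : Param k) :
    Integrable (fun x => q x θ * score q x θ u ^ 2) μ := by
  obtain ⟨K, hK0, hK⟩ := exists_pow_mul_exp_le hσ 2
  refine hq.integrable_mul_of_abs_le hθ hi ((hq.measurable_score hθ u).pow_const 2)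
    (K := ‖u‖ ^ 2 * K) fun x => ?_
  have hM := hq.envelope_nonneg hθ x
  have h1 : |score q x θ u| ≤ envelope q h θ x * ‖u‖ :=
    ((score q x θ).le_opNorm u).trans
      (mul_le_mul_of_nonneg_right (hq.norm_score_le_envelope hθ x) (norm_nonneg u))
  have h2 : 1 ≤ Real.exp (σ / 2 * envelope q h θ x) := Real.one_le_exp (by positivity)
  calc |score q x θ u ^ 2| = |score q x θ u| ^ 2 := abs_pow _ _
    _ ≤ (envelope q h θ x * ‖u‖) ^ 2 := by gcongr
    _ = ‖u‖ ^ 2 * (envelope q h θ x ^ 2 * 1) := by ring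
    _ ≤ ‖u‖ ^ 2 * (envelope q h θ x ^ 2 * Real.exp (σ / 2 * envelope q h θ x)) := by gcongr
    _ ≤ ‖u‖ ^ 2 * (K * Real.exp (σ * envelope q h θ x)) :=
        mul_le_mul_of_nonneg_left (hK _ hM) (by positivity)
    _ = _ := by ring

/-- The information identity. -/
theorem integral_score_sq_add_hessian (hq : IsRegularFamily μ U τ B h q) {δ : ℝ} (hδ : 0 < δ)
    (hθδ : Metric.closedBall θ δ ⊆ U) (hσ : 0 < σ)
    (hi : Integrable (fun x => q x θ * Real.exp (σ * envelope q h θ x)) μ) (u : Param k) :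
    ∫ x, q x θ * (score q x θ u ^ 2 + fderiv ℝ (score q x) θ u u) ∂μ = 0 := by
  obtain ⟨K₁, hK₁0, hK₁⟩ := exists_pow_mul_exp_le hσ 1
  obtain ⟨K₂, hK₂0, hK₂⟩ := exists_pow_mul_exp_le hσ 2
  set η : ℝ := min δ (min 1 (σ / 2)) with hη
  have hη0 : 0 < η := by positivity
  -- Keeps `‖s • u‖ ≤ η` for `|s| < ρ`; the `+ 1` covers `u = 0`.
  set ρ : ℝ := η / (‖u‖ + 1) with hρ
  have hu0 := norm_nonneg u
  have hρ0 : 0 < ρ := by positivity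
  have hη1 : η ≤ 1 := (min_le_right _ _).trans (min_le_left _ _)
  have hησ : η ≤ σ / 2 := (min_le_right _ _).trans (min_le_right _ _)
  have hsu : ∀ s ∈ Metric.ball (0 : ℝ) ρ, ‖s • u‖ ≤ η := fun s hs => by
    rw [mem_ball_zero_iff] at hs
    rw [norm_smul]
    have h1 : ‖s‖ * ‖u‖ ≤ ρ * (‖u‖ + 1) := by gcongr; linarith
    rwa [hρ, div_mul_cancel₀ _ (by positivity)] at h1
  have hmem : θ ∈ Metric.closedBall θ δ := Metric.mem_closedBall_self hδ.le
  have hθ := hθδ hmem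
  have hmem' : ∀ s ∈ Metric.ball (0 : ℝ) ρ, θ + s • u ∈ Metric.closedBall θ δ := fun s hs => by
    rw [mem_closedBall_iff_norm, add_sub_cancel_left]
    exact (hsu s hs).trans (min_le_left _ _)
  have hM0 := fun x => hq.envelope_nonneg hθ x
  have hcv := convex_closedBall θ δ
  -- The density along a line, written as an exponential so that its derivatives are expressed by
  -- score and Hessian. Its integral is constantly one, and it is differentiated twice under the
  -- integral sign.
  set F : ℝ → X → ℝ := fun s x => Real.exp (Real.log (q x (θ + s • u))) with hF
  set F' : ℝ → X → ℝ := fun s x => F s x * score q x (θ + s • u) u with hF'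
  set F'' : ℝ → X → ℝ := fun s x => F s x *
    (score q x (θ + s • u) u ^ 2 + fderiv ℝ (score q x) (θ + s • u) u u) with hF''
  have hFq : ∀ s ∈ Metric.ball (0 : ℝ) ρ, F s = fun x => q x (θ + s • u) := fun s hs => by
    ext x; exact Real.exp_log (hq.pos x _ (hθδ (hmem' s hs)))
  have hline : ∀ s : ℝ, HasDerivAt (fun s : ℝ => θ + s • u) u s := fun s => by
    simpa using ((hasDerivAt_id s).smul_const u).const_add θ
  have hdF : ∀ x, ∀ s ∈ Metric.ball (0 : ℝ) ρ, HasDerivAt (F · x) (F' s x) s := fun x s hs => by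
    have h1 := (hq.differentiableAt (hθδ (hmem' s hs)) x).hasFDerivAt
    exact (h1.comp_hasDerivAt s (hline s)).exp
  have hdS : ∀ x, ∀ s ∈ Metric.ball (0 : ℝ) ρ, HasDerivAt (fun s => score q x (θ + s • u) u)
      (fderiv ℝ (score q x) (θ + s • u) u u) s := fun x s hs =>
    (ContinuousLinearMap.apply ℝ ℝ u).hasFDerivAt.comp_hasDerivAt s
      ((hq.differentiableAt_score (hθδ (hmem' s hs)) x).hasFDerivAt.comp_hasDerivAt s (hline s))
  have hdF' : ∀ x, ∀ s ∈ Metric.ball (0 : ℝ) ρ, HasDerivAt (F' · x) (F'' s x) s :=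
    fun x s hs => by
      convert! (hdF x s hs).mul (hdS x s hs) using 1
      simp only [hF'', hF']
      ring
  have hmF : ∀ s ∈ Metric.ball (0 : ℝ) ρ, Measurable (F s) := fun s hs =>
    Real.measurable_exp.comp (hq.measurable_log (hθδ (hmem' s hs)))
  have hmF' : ∀ s ∈ Metric.ball (0 : ℝ) ρ, Measurable (F' s) := fun s hs =>
    (hmF s hs).mul (hq.measurable_score (hθδ (hmem' s hs)) u)
  have hmF'' : ∀ s ∈ Metric.ball (0 : ℝ) ρ, Measurable (F'' s) := fun s hs =>
    (hmF s hs).mul (((hq.measurable_score (hθδ (hmem' s hs)) u).pow_const 2).add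
      (hq.measurable_hessian (hθδ (hmem' s hs)) u u))
  have hbF : ∀ x, ∀ s ∈ Metric.ball (0 : ℝ) ρ,
      F s x ≤ q x θ * Real.exp (σ / 2 * envelope q h θ x) := fun x s hs => by
    have h1 := hq.abs_log_sub_le hcv hθδ hmem (hmem' s hs)
      (by rw [add_sub_cancel_left]; exact (hsu s hs).trans hη1) x
    rw [add_sub_cancel_left] at h1
    have h2 : ‖s • u‖ * envelope q h θ x ≤ σ / 2 * envelope q h θ x :=
      mul_le_mul_of_nonneg_right ((hsu s hs).trans hησ) (hM0 x)
    calc F s x ≤ Real.exp (Real.log (q x θ) + σ / 2 * envelope q h θ x) :=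
          Real.exp_le_exp.2 (by linarith [(abs_le.1 h1).2])
      _ = _ := by rw [Real.exp_add, Real.exp_log (hq.pos x θ hθ)]
  have hbS : ∀ x, ∀ s ∈ Metric.ball (0 : ℝ) ρ,
      |score q x (θ + s • u) u| ≤ envelope q h θ x * ‖u‖ := fun x s hs => by
    refine ((score q x (θ + s • u)).le_opNorm u).trans ?_
    gcongr
    have h1 := hq.norm_score_sub_le hcv hθδ hmem (hmem' s hs) x
    rw [add_sub_cancel_left] at h1
    have h2 := norm_le_norm_add_norm_sub' (score q x (θ + s • u)) (score q x θ)
    have h3 : h x * ‖s • u‖ ≤ h x * 1 :=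
      mul_le_mul_of_nonneg_left ((hsu s hs).trans hη1) (hq.h_nonneg hθ x)
    linarith [norm_score_add_le_envelope q h θ x]
  have hbH : ∀ x, ∀ s ∈ Metric.ball (0 : ℝ) ρ,
      |fderiv ℝ (score q x) (θ + s • u) u u| ≤ envelope q h θ x * ‖u‖ ^ 2 := fun x s hs => by
    have h1 := ((fderiv ℝ (score q x) (θ + s • u)).le_opNorm₂ u u)
    have h2 := (hq.two x _ (hθδ (hmem' s hs))).trans (h_le_envelope q h θ x)
    calc _ ≤ _ := h1
      _ ≤ envelope q h θ x * ‖u‖ * ‖u‖ := by gcongr; exact h2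
      _ = _ := by ring
  have hF0 : ∀ s x, 0 < F s x := fun s x => Real.exp_pos _
  have hbF' : ∀ x, ∀ s ∈ Metric.ball (0 : ℝ) ρ,
      ‖F' s x‖ ≤ ‖u‖ * K₁ * (q x θ * Real.exp (σ * envelope q h θ x)) := fun x s hs => by
    have hp := hq.pos x θ hθ
    have hM := hM0 x
    have h1 := hK₁ _ (hM0 x)
    rw [pow_one] at h1
    calc ‖F' s x‖ = F s x * |score q x (θ + s • u) u| := by
          rw [Real.norm_eq_abs, abs_mul, abs_of_pos (hF0 s x)]
      _ ≤ q x θ * Real.exp (σ / 2 * envelope q h θ x) * (envelope q h θ x * ‖u‖) :=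
          mul_le_mul (hbF x s hs) (hbS x s hs) (abs_nonneg _) (by positivity)
      _ = ‖u‖ * q x θ * (envelope q h θ x * Real.exp (σ / 2 * envelope q h θ x)) := by ring
      _ ≤ ‖u‖ * q x θ * (K₁ * Real.exp (σ * envelope q h θ x)) := by gcongr
      _ = _ := by ring
  have hbF'' : ∀ x, ∀ s ∈ Metric.ball (0 : ℝ) ρ,
      ‖F'' s x‖ ≤ ‖u‖ ^ 2 * (K₂ + K₁) * (q x θ * Real.exp (σ * envelope q h θ x)) :=
    fun x s hs => by
    have hp := hq.pos x θ hθ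
    have hM := hM0 x
    have h1 := hK₁ _ (hM0 x)
    have h2 := hK₂ _ (hM0 x)
    rw [pow_one] at h1
    have h3 : |score q x (θ + s • u) u ^ 2 + fderiv ℝ (score q x) (θ + s • u) u u| ≤
        (envelope q h θ x * ‖u‖) ^ 2 + envelope q h θ x * ‖u‖ ^ 2 := by
      refine (abs_add_le _ _).trans (add_le_add ?_ (hbH x s hs))
      rw [abs_pow]
      exact pow_le_pow_left₀ (abs_nonneg _) (hbS x s hs) 2
    calc ‖F'' s x‖ = F s x * |score q x (θ + s • u) u ^ 2 +
          fderiv ℝ (score q x) (θ + s • u) u u| := by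
          rw [Real.norm_eq_abs, abs_mul, abs_of_pos (hF0 s x)]
      _ ≤ q x θ * Real.exp (σ / 2 * envelope q h θ x) *
          ((envelope q h θ x * ‖u‖) ^ 2 + envelope q h θ x * ‖u‖ ^ 2) :=
          mul_le_mul (hbF x s hs) h3 (abs_nonneg _) (by positivity)
      _ = ‖u‖ ^ 2 * q x θ * (envelope q h θ x ^ 2 * Real.exp (σ / 2 * envelope q h θ x) +
          envelope q h θ x * Real.exp (σ / 2 * envelope q h θ x)) := by ring
      _ ≤ ‖u‖ ^ 2 * q x θ * (K₂ * Real.exp (σ * envelope q h θ x) +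
          K₁ * Real.exp (σ * envelope q h θ x)) := by gcongr
      _ = _ := by ring
  have hnhds : ∀ s ∈ Metric.ball (0 : ℝ) ρ, Metric.ball (0 : ℝ) ρ ∈ 𝓝 s := fun s hs =>
    Metric.isOpen_ball.mem_nhds hs
  have step : ∀ s ∈ Metric.ball (0 : ℝ) ρ, Integrable (F' s) μ ∧ ∫ x, F' s x ∂μ = 0 :=
    fun s hs => by
    have h1 := hasDerivAt_integral_of_dominated_loc_of_deriv_le (μ := μ) (F := F) (F' := F')
      (bound := fun x => ‖u‖ * K₁ * (q x θ * Real.exp (σ * envelope q h θ x))) (hnhds s hs)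
      (by filter_upwards [hnhds s hs] with t ht using (hmF t ht).aestronglyMeasurable)
      (by rw [hFq s hs]; exact hq.integrable (hθδ (hmem' s hs)))
      (hmF' s hs).aestronglyMeasurable (ae_of_all _ hbF') (hi.const_mul _) (ae_of_all _ hdF)
    refine ⟨h1.1, h1.2.unique ?_⟩
    refine (hasDerivAt_const s (1 : ℝ)).congr_of_eventuallyEq ?_
    filter_upwards [hnhds s hs] with t ht
    rw [hFq t ht]
    exact hq.integral_eq_one (hθδ (hmem' t ht))
  have h0 : (0 : ℝ) ∈ Metric.ball (0 : ℝ) ρ := Metric.mem_ball_self hρ0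
  have h1 := hasDerivAt_integral_of_dominated_loc_of_deriv_le (μ := μ) (F := F') (F' := F'')
    (bound := fun x => ‖u‖ ^ 2 * (K₂ + K₁) * (q x θ * Real.exp (σ * envelope q h θ x)))
    (hnhds 0 h0)
    (by filter_upwards [hnhds 0 h0] with t ht using (hmF' t ht).aestronglyMeasurable)
    (step 0 h0).1 (hmF'' 0 h0).aestronglyMeasurable (ae_of_all _ hbF'') (hi.const_mul _)
    (ae_of_all _ hdF')
  have h2 : ∫ x, F'' 0 x ∂μ = 0 := by
    refine h1.2.unique ((hasDerivAt_const 0 (0 : ℝ)).congr_of_eventuallyEq ?_)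
    filter_upwards [hnhds 0 h0] with t ht using (step t ht).2
  rw [← h2]
  refine integral_congr_ae (ae_of_all _ fun x => ?_)
  simp only [hF'', hFq 0 h0, zero_smul, add_zero]

/-- The Hellinger distance is locally at least the quadratic form of the Fisher information at the
centre, up to a small multiple of the squared distance. -/
theorem exists_le_one_sub_affinity {δ : ℝ} (hδ : 0 < δ) (hτ : 0 < τ) :
    ∃ η > 0, ∃ A : ℝ, 0 ≤ A ∧ ∀ h q, IsRegularFamily μ U τ B h q → ∀ θ,
      Metric.closedBall θ δ ⊆ U → ∀ r ≤ η, ∀ a ∈ Metric.closedBall θ r,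
        ∀ b ∈ Metric.closedBall θ r,
          (∫ x, q x θ * score q x θ (a - b) ^ 2 ∂μ) / 16 - A * r ^ 2 * ‖a - b‖ ^ 2 ≤
            1 - affinity μ q a b := by
  obtain ⟨σ, hσ, C, hC0, hC⟩ := exists_exp_envelope_le (μ := μ) (U := U) (B := B) hδ hτ
  obtain ⟨K₂, hK₂0, hK₂⟩ := exists_pow_mul_exp_le hσ 2
  obtain ⟨K₄, hK₄0, hK₄⟩ := exists_pow_mul_exp_le hσ 4
  refine ⟨min δ (min 1 (σ / 2)), by positivity, (K₂ + K₄) * C, by positivity, ?_⟩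
  intro h q hq θ hθδ r hr a ha b hb
  obtain ⟨hi, hiC⟩ := hC h q hq θ hθδ
  have hr0 : 0 ≤ r := (norm_nonneg _).trans (mem_closedBall_iff_norm.1 ha)
  have hrδ : r ≤ δ := hr.trans (min_le_left _ _)
  have hr1 : r ≤ 1 := hr.trans ((min_le_right _ _).trans (min_le_left _ _))
  have hrσ : r ≤ σ / 2 := hr.trans ((min_le_right _ _).trans (min_le_right _ _))
  have hrU : Metric.closedBall θ r ⊆ U := (Metric.closedBall_subset_closedBall hrδ).trans hθδ
  have hcv := convex_closedBall θ r
  have hmem : θ ∈ Metric.closedBall θ r := Metric.mem_closedBall_self hr0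
  have hθ := hrU hmem
  have hM0 := fun x => hq.envelope_nonneg hθ x
  -- The square root of the likelihood ratio against the centre. Linearising at the fixed centre
  -- `θ`, rather than at `a` or `b`, makes the error proportional to `‖a - b‖` with a factor `r`, so
  -- Fisher information at one point controls the whole ball.
  set f : X → Param k → ℝ := fun x t => Real.exp ((Real.log (q x t) - Real.log (q x θ)) / 2) with hf
  have hrem : ∀ x, |f x a - f x b - score q x θ (a - b) / 2| ≤
      r * (envelope q h θ x + envelope q h θ x ^ 2) *
        Real.exp (r / 2 * envelope q h θ x) * ‖a - b‖ := by
    intro x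
    have hd : ∀ t ∈ Metric.closedBall θ r, HasFDerivWithinAt (f x)
        (f x t • ((2 : ℝ)⁻¹ • score q x t)) (Metric.closedBall θ r) t := fun t ht => by
      have h1 := ((hq.differentiableAt (hrU ht) x).hasFDerivAt.sub_const
        (Real.log (q x θ))).const_mul (2 : ℝ)⁻¹
      have h2 := h1.exp
      simp only [hf, div_eq_inv_mul]
      exact h2.hasFDerivWithinAt
    have hM := hM0 x
    have hbound : ∀ t ∈ Metric.closedBall θ r,
        ‖f x t • ((2 : ℝ)⁻¹ • score q x t) - (2 : ℝ)⁻¹ • score q x θ‖ ≤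
          r * (envelope q h θ x + envelope q h θ x ^ 2) *
            Real.exp (r / 2 * envelope q h θ x) := fun t ht => by
      have htr : ‖t - θ‖ ≤ r := mem_closedBall_iff_norm.1 ht
      have h1 := hq.abs_log_sub_le hcv hrU hmem ht (htr.trans hr1) x
      have h2 : |(Real.log (q x t) - Real.log (q x θ)) / 2| ≤ r / 2 * envelope q h θ x := by
        rw [abs_div, abs_two]
        have := mul_le_mul_of_nonneg_right htr hM
        linarith
      have h3 : f x t ≤ Real.exp (r / 2 * envelope q h θ x) :=
        Real.exp_le_exp.2 ((le_abs_self _).trans h2)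
      have h4 : |f x t - 1| ≤ r / 2 * envelope q h θ x * Real.exp (r / 2 * envelope q h θ x) :=
        (abs_exp_sub_one_le _).trans
          (mul_le_mul h2 (Real.exp_le_exp.2 h2) (Real.exp_pos _).le (by positivity))
      have h5 : ‖score q x t - score q x θ‖ ≤ envelope q h θ x * r :=
        (hq.norm_score_sub_le hcv hrU hmem ht x).trans
          (mul_le_mul (h_le_envelope q h θ x) htr (norm_nonneg _) hM)
      have h6 := hq.norm_score_le_envelope hθ x
      have he : f x t • ((2 : ℝ)⁻¹ • score q x t) - (2 : ℝ)⁻¹ • score q x θ =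
          (f x t / 2) • (score q x t - score q x θ) + ((f x t - 1) / 2) • score q x θ := by
        module
      rw [he]
      refine (norm_add_le _ _).trans ?_
      rw [norm_smul, norm_smul, Real.norm_eq_abs, Real.norm_eq_abs, abs_div, abs_div, abs_two,
        abs_of_pos (Real.exp_pos _ : 0 < f x t)]
      have e0 := Real.exp_pos (r / 2 * envelope q h θ x)
      calc f x t / 2 * ‖score q x t - score q x θ‖ + |f x t - 1| / 2 * ‖score q x θ‖
          ≤ Real.exp (r / 2 * envelope q h θ x) / 2 * (envelope q h θ x * r) +
            r / 2 * envelope q h θ x * Real.exp (r / 2 * envelope q h θ x) / 2 *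
              envelope q h θ x := by gcongr
        _ = r * (envelope q h θ x / 2 + envelope q h θ x ^ 2 / 4) *
            Real.exp (r / 2 * envelope q h θ x) := by ring
        _ ≤ _ := by
            gcongr
            · linarith
            · nlinarith [sq_nonneg (envelope q h θ x)]
    have := hcv.norm_image_sub_le_of_norm_hasFDerivWithin_le' hd hbound hb ha
    rw [Real.norm_eq_abs] at this
    have e : ((2 : ℝ)⁻¹ • score q x θ) (a - b) = score q x θ (a - b) / 2 := by
      rw [_root_.smul_apply, smul_eq_mul]; ring
    rwa [e] at this
  have hmeas : Measurable fun x => score q x θ (a - b) := hq.measurable_score hθ _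
  -- With `x = f a - f b` and `y` half the score increment, `y² / 2 - x² ≤ (x - y)²`; the right side
  -- is the squared linearisation error.
  set D : X → ℝ := fun x => score q x θ (a - b) ^ 2 / 8 - (f x a - f x b) ^ 2 with hD
  have hsq : ∀ t ∈ Metric.closedBall θ r, ∀ x, √(q x t) = √(q x θ) * f x t := fun t ht x => by
    have h1 : √(q x θ) * f x t = Real.exp (Real.log (q x t) / 2) := by
      rw [← Real.exp_log (Real.sqrt_pos.2 (hq.pos x θ hθ)), Real.log_sqrt (hq.pos x θ hθ).le,
        ← Real.exp_add]
      congr 1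
      ring
    rw [h1, ← Real.log_sqrt (hq.pos x t (hrU ht)).le,
      Real.exp_log (Real.sqrt_pos.2 (hq.pos x t (hrU ht)))]
  have hqD : ∀ x, q x θ * D x =
      (q x θ * score q x θ (a - b) ^ 2) / 8 - (√(q x a) - √(q x b)) ^ 2 := fun x => by
    simp only [hD]
    rw [hsq a ha, hsq b hb]
    linear_combination ((f x a - f x b) ^ 2) * Real.sq_sqrt (hq.pos x θ hθ).le
  have hs1 := (hq.integrable_score_sq hθ hσ hi (a - b)).div_const 8
  have hs2 := hq.integrable_sqrt_sub_sqrt_sq (hrU ha) (hrU hb)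
  have hDi : Integrable (fun x => q x θ * D x) μ := by
    simp only [hqD]
    exact hs1.sub hs2
  have hfin := hq.integral_mul_le_of_le hθ hi hiC (K := 2 * (r ^ 2 * ‖a - b‖ ^ 2 * (K₂ + K₄)))
    (by positivity) hDi fun x => by
      have hM := hM0 x
      have h1 := hrem x
      have h2 : (f x a - f x b - score q x θ (a - b) / 2) ^ 2 ≤
          2 * (r ^ 2 * ‖a - b‖ ^ 2 * (K₂ + K₄)) * Real.exp (σ * envelope q h θ x) := by
        have e1 : Real.exp (r / 2 * envelope q h θ x) ^ 2 ≤
            Real.exp (σ / 2 * envelope q h θ x) := by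
          rw [← Real.exp_nat_mul]
          refine Real.exp_le_exp.2 ?_
          have := mul_le_mul_of_nonneg_right hrσ hM
          push_cast
          linarith
        calc (f x a - f x b - score q x θ (a - b) / 2) ^ 2
            ≤ (r * (envelope q h θ x + envelope q h θ x ^ 2) *
              Real.exp (r / 2 * envelope q h θ x) * ‖a - b‖) ^ 2 := by
              rw [← sq_abs]; gcongr
          _ = r ^ 2 * ‖a - b‖ ^ 2 * ((envelope q h θ x + envelope q h θ x ^ 2) ^ 2 *
              Real.exp (r / 2 * envelope q h θ x) ^ 2) := by ring
          _ ≤ r ^ 2 * ‖a - b‖ ^ 2 * ((2 * envelope q h θ x ^ 2 + 2 * envelope q h θ x ^ 4) *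
              Real.exp (σ / 2 * envelope q h θ x)) := by
              gcongr
              nlinarith [sq_nonneg (envelope q h θ x - envelope q h θ x ^ 2)]
          _ = r ^ 2 * ‖a - b‖ ^ 2 * (2 * (envelope q h θ x ^ 2 *
              Real.exp (σ / 2 * envelope q h θ x)) + 2 * (envelope q h θ x ^ 4 *
              Real.exp (σ / 2 * envelope q h θ x))) := by ring
          _ ≤ r ^ 2 * ‖a - b‖ ^ 2 * (2 * (K₂ * Real.exp (σ * envelope q h θ x)) +
              2 * (K₄ * Real.exp (σ * envelope q h θ x))) := by
              have := hK₂ _ hM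
              have := hK₄ _ hM
              gcongr
          _ = _ := by ring
      have h3 : D x ≤ (f x a - f x b - score q x θ (a - b) / 2) ^ 2 := by
        simp only [hD]
        nlinarith [sq_nonneg (2 * (f x a - f x b) - score q x θ (a - b) / 2)]
      exact h3.trans h2
  simp only [hqD] at hfin
  rw [integral_sub hs1 hs2, integral_div, hq.integral_sqrt_sub_sqrt_sq (hrU ha) (hrU hb)] at hfin
  linarith

theorem integrable_hessian (hq : IsRegularFamily μ U τ B h q) (hθ : θ ∈ U)
    (hσ : 0 < σ) (hi : Integrable (fun x => q x θ * Real.exp (σ * envelope q h θ x)) μ) (u v : Param k) :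
    Integrable (fun x => q x θ * fderiv ℝ (score q x) θ u v) μ := by
  refine hq.integrable_mul_of_abs_le hθ hi (hq.measurable_hessian hθ u v)
    (K := ‖u‖ * ‖v‖ / σ) fun x => ?_
  have hM := hq.envelope_nonneg hθ x
  have h1 : ‖fderiv ℝ (score q x) θ u v‖ ≤ envelope q h θ x * ‖u‖ * ‖v‖ := by
    refine ((fderiv ℝ (score q x) θ).le_opNorm₂ u v).trans ?_
    gcongr
    exact (hq.two x θ hθ).trans (h_le_envelope q h θ x)
  have h2 : σ * envelope q h θ x ≤ Real.exp (σ * envelope q h θ x) :=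
    (lt_add_one _).le.trans (Real.add_one_le_exp _)
  calc |fderiv ℝ (score q x) θ u v| ≤ _ := h1
    _ = ‖u‖ * ‖v‖ / σ * (σ * envelope q h θ x) := by field_simp
    _ ≤ _ := by gcongr

/-- Convexity gives `exp (s h) ≤ 1 + (s / τ) exp (τ h)`. A bound tending to one like `1 + O(s)` is
needed, since it is raised to the power `n` with `s` of order `1 / n`. -/
theorem lintegral_exp_mul_le (hq : IsRegularFamily μ U τ B h q) (hτ : 0 < τ)
    (hθ : θ ∈ U) {s : ℝ} (hs0 : 0 ≤ s) (hsτ : s ≤ τ) :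
    ∫⁻ x, ENNReal.ofReal (q x θ * Real.exp (s * h x)) ∂μ ≤
      ENNReal.ofReal (Real.exp (s / τ * |B|)) := by
  have hE := hq.integrable_exp_mul hθ
  have hle : ∀ x, q x θ * Real.exp (s * h x) ≤
      q x θ + s / τ * (Real.exp (τ * h x) * q x θ) := fun x => by
    have hp := hq.pos x θ hθ
    have hst : s / τ ≤ 1 := (div_le_one hτ).2 hsτ
    have hst0 : 0 ≤ s / τ := by positivity
    have hcv := convexOn_exp.2 (Set.mem_univ (0 : ℝ)) (Set.mem_univ (τ * h x))
      (sub_nonneg.2 hst) hst0 (by ring)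
    simp only [smul_eq_mul, mul_zero, zero_add, Real.exp_zero, mul_one] at hcv
    have e : s / τ * (τ * h x) = s * h x := by field_simp
    rw [e] at hcv
    have h1 := mul_le_mul_of_nonneg_left hcv hp.le
    have h2 : 0 ≤ s / τ * q x θ := by positivity
    linarith
  have hi : Integrable (fun x => q x θ + s / τ * (Real.exp (τ * h x) * q x θ)) μ :=
    (hq.integrable hθ).add (hE.1.const_mul _)
  calc _ ≤ ∫⁻ x, ENNReal.ofReal (q x θ + s / τ * (Real.exp (τ * h x) * q x θ)) ∂μ :=
        lintegral_mono fun x => ENNReal.ofReal_le_ofReal (hle x)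
    _ = ENNReal.ofReal (∫ x, (q x θ + s / τ * (Real.exp (τ * h x) * q x θ)) ∂μ) := by
        rw [ofReal_integral_eq_lintegral_ofReal hi (ae_of_all _ fun x => ?_)]
        have hp := hq.pos x θ hθ
        simp only [Pi.zero_apply]
        positivity
    _ ≤ _ := by
        refine ENNReal.ofReal_le_ofReal ?_
        rw [integral_add (hq.integrable hθ) (hE.1.const_mul _), integral_const_mul,
          hq.integral_eq_one hθ]
        have h1 := mul_le_mul_of_nonneg_left hE.2 (by positivity : 0 ≤ s / τ)
        have h2 := Real.add_one_le_exp (s / τ * |B|)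
        linarith

end IsRegularFamily

/-! ### Independent observations -/

section Product

variable {X : Type*} [MeasurableSpace X] {k : ℕ} {μ : Measure X}
  {U : Set (Param k)} {τ B : ℝ} {h : ℕ → X → ℝ} {q : ℕ → X → Param k → ℝ} {θ a b : Param k} {n : ℕ}

theorem jointDensity_pos {X : Type*} {k : ℕ} {U : Set (Param k)} {q : ℕ → X → Param k → ℝ}
    (hq : ∀ i x, ∀ θ ∈ U, 0 < q i x θ) {θ : Param k} (hθ : θ ∈ U) {n : ℕ} (y : Fin n → X) :
    0 < jointDensity q n y θ :=
  Finset.prod_pos fun i _ => hq i (y i) θ hθ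

theorem log_jointDensity {X : Type*} {k : ℕ} {U : Set (Param k)} {q : ℕ → X → Param k → ℝ}
    (hq : ∀ i x, ∀ θ ∈ U, 0 < q i x θ) {θ : Param k} (hθ : θ ∈ U) {n : ℕ} (y : Fin n → X) :
    Real.log (jointDensity q n y θ) = ∑ i : Fin n, Real.log (q i (y i) θ) :=
  Real.log_prod fun i _ => (hq i (y i) θ hθ).ne'

theorem measurable_jointDensity (hq : ∀ i, IsRegularFamily μ U τ B (h i) (q i)) (hθ : θ ∈ U) :
    Measurable fun y : Fin n → X => jointDensity q n y θ :=
  Finset.measurable_fun_prod _ fun i _ => ((hq i).meas θ hθ).comp (measurable_pi_apply i)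

theorem ofReal_jointDensity (hq : ∀ i, IsRegularFamily μ U τ B (h i) (q i)) (hθ : θ ∈ U)
    (y : Fin n → X) :
    ENNReal.ofReal (jointDensity q n y θ) = ∏ i : Fin n, ENNReal.ofReal (q i (y i) θ) :=
  ENNReal.ofReal_prod_of_nonneg fun i _ => ((hq i).pos (y i) θ hθ).le

theorem prod_affinity_le_exp (hq : ∀ i, IsRegularFamily μ U τ B (h i) (q i))
    (ha : a ∈ U) (hb : b ∈ U) :
    ∏ i : Fin n, affinity μ (q i) a b ≤
      Real.exp (-∑ i : Fin n, (1 - affinity μ (q i) a b)) := by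
  rw [← Finset.sum_neg_distrib, Real.exp_sum]
  refine Finset.prod_le_prod (fun i _ => ((hq i).affinity_pos ha hb).le) fun i _ => ?_
  have := Real.add_one_le_exp (-(1 - affinity μ (q i) a b))
  linarith

theorem sqrt_jointDensity_mul (y : Fin n → X)
    (hq : ∀ i, IsRegularFamily μ U τ B (h i) (q i)) (ha : a ∈ U) (hb : b ∈ U) :
    √(jointDensity q n y a) * √(jointDensity q n y b) =
      ∏ i : Fin n, (√(q i (y i) a) * √(q i (y i) b)) := by
  have hs : ∀ c ∈ U, √(jointDensity q n y c) = ∏ i : Fin n, √(q i (y i) c) := fun c hc => by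
    rw [Real.sqrt_eq_iff_mul_self_eq (jointDensity_pos (fun i => (hq i).pos) hc y).le
      (Finset.prod_nonneg fun i _ => Real.sqrt_nonneg _), ← Finset.prod_mul_distrib]
    exact Finset.prod_congr rfl fun i _ => (Real.mul_self_sqrt ((hq i).pos (y i) c hc).le).symm
  rw [hs a ha, hs b hb, Finset.prod_mul_distrib]

theorem iteratedFDeriv_two_log_jointDensity (hq : ∀ i, IsRegularFamily μ U τ B (h i) (q i))
    (hθ : θ ∈ U) (y : Fin n → X) (u v : Param k) :
    iteratedFDeriv ℝ 2 (fun t => Real.log (jointDensity q n y t)) θ ![u, v] =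
      ∑ i : Fin n, fderiv ℝ (score (q i) (y i)) θ u v := by
  rw [iteratedFDeriv_two_apply]
  have h1 : fderiv ℝ (fun t => Real.log (jointDensity q n y t)) =ᶠ[𝓝 θ]
      fun t => ∑ i : Fin n, score (q i) (y i) t := by
    filter_upwards [(hq 0).isOpen.mem_nhds hθ] with t ht
    have h2 : (fun t => Real.log (jointDensity q n y t)) =ᶠ[𝓝 t]
        fun t => ∑ i : Fin n, Real.log (q i (y i) t) := by
      filter_upwards [(hq 0).isOpen.mem_nhds ht] with s hs
        using log_jointDensity (fun i => (hq i).pos) hs y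
    rw [h2.fderiv_eq]
    exact fderiv_fun_sum fun i _ => (hq i).differentiableAt ht (y i)
  rw [h1.fderiv_eq, fderiv_fun_sum fun (i : Fin n) _ => (hq i).differentiableAt_score hθ (y i)]
  simp [_root_.sum_apply]

variable [SigmaFinite μ]

theorem lintegral_jointDensity (hq : ∀ i, IsRegularFamily μ U τ B (h i) (q i)) (hθ : θ ∈ U) :
    ∫⁻ y, ENNReal.ofReal (jointDensity q n y θ) ∂(Measure.pi fun _ : Fin n => μ) = 1 := by
  simp only [ofReal_jointDensity hq hθ]
  rw [lintegral_pi_prod (fun _ : Fin n => μ) (fun i x => ENNReal.ofReal (q i x θ))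
    fun i => ((hq i).meas θ hθ).ennreal_ofReal]
  exact Finset.prod_eq_one fun i _ => (hq i).one θ hθ

/-- Reduces expectations of functions of one coordinate to integrals over one observation. -/
theorem dist_eq_pi (hq : ∀ i, IsRegularFamily μ U τ B (h i) (q i)) (hθ : θ ∈ U) :
    dist μ q n θ =
      Measure.pi fun i : Fin n => μ.withDensity fun x => ENNReal.ofReal (q i x θ) := by
  have hprob : ∀ i : Fin n,
      IsProbabilityMeasure (μ.withDensity fun x => ENNReal.ofReal (q i x θ)) := fun i =>
    isProbabilityMeasure_withDensity ((hq i).one θ hθ)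
  refine (Measure.pi_eq fun s hs => ?_).symm
  rw [dist, withDensity_apply _ (MeasurableSet.univ_pi hs), Measure.restrict_pi_pi]
  simp only [ofReal_jointDensity hq hθ]
  rw [lintegral_pi_prod (fun i : Fin n => μ.restrict (s i)) (fun i x => ENNReal.ofReal (q i x θ))
    fun i => ((hq i).meas θ hθ).ennreal_ofReal]
  exact Finset.prod_congr rfl fun i _ => (withDensity_apply _ (hs i)).symm

theorem integrable_sqrt_jointDensity_mul (hq : ∀ i, IsRegularFamily μ U τ B (h i) (q i))
    (ha : a ∈ U) (hb : b ∈ U) :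
    Integrable (fun y => √(jointDensity q n y a) * √(jointDensity q n y b))
      (Measure.pi fun _ : Fin n => μ) := by
  simp only [sqrt_jointDensity_mul _ hq ha hb]
  exact Integrable.fintype_prod (μ := fun _ : Fin n => μ)
    (f := fun (i : Fin n) x => √(q i x a) * √(q i x b))
    fun i => (hq i).integrable_sqrt_mul_sqrt ha hb

theorem integral_sqrt_jointDensity_mul (hq : ∀ i, IsRegularFamily μ U τ B (h i) (q i))
    (ha : a ∈ U) (hb : b ∈ U) :
    ∫ y, √(jointDensity q n y a) * √(jointDensity q n y b) ∂(Measure.pi fun _ : Fin n => μ) =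
      ∏ i : Fin n, affinity μ (q i) a b := by
  simp only [sqrt_jointDensity_mul _ hq ha hb]
  exact integral_fintype_prod_eq_prod (μ := fun _ : Fin n => μ)
    (f := fun (i : Fin n) x => √(q i x a) * √(q i x b))

/-- The affinity is multiplicative over coordinates, and `-2 log` of the product is at least twice
the sum of the defects by `x ≤ exp (-(1 - x))`. -/
theorem two_mul_sum_one_sub_affinity_le_klDiv
    (hq : ∀ i, IsRegularFamily μ U τ B (h i) (q i)) (ha : a ∈ U) (hb : b ∈ U) :
    ENNReal.ofReal (2 * ∑ i : Fin n, (1 - affinity μ (q i) a b)) ≤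
      InformationTheory.klDiv (dist μ q n a) (dist μ q n b) := by
  have hpos : 0 < ∏ i : Fin n, affinity μ (q i) a b :=
    Finset.prod_pos fun i _ => (hq i).affinity_pos ha hb
  refine le_trans (ENNReal.ofReal_le_ofReal ?_)
    (neg_two_log_affinity_le_klDiv (measurable_jointDensity hq ha) (measurable_jointDensity hq hb)
      (jointDensity_pos (fun i => (hq i).pos) ha) (jointDensity_pos (fun i => (hq i).pos) hb)
      (lintegral_jointDensity hq ha) (lintegral_jointDensity hq hb) hpos
      (integrable_sqrt_jointDensity_mul hq ha hb) (integral_sqrt_jointDensity_mul hq ha hb))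
  have h1 := (Real.log_le_log_iff hpos (Real.exp_pos _)).2 (prod_affinity_le_exp (n := n) hq ha hb)
  rw [Real.log_exp] at h1
  linarith

/-- The log-likelihood ratio is a sum over coordinates and `g / f - 1` has mean zero, so the
divergence is the sum of the single-observation divergences. -/
theorem klDiv_dist_le (hq : ∀ i, IsRegularFamily μ U τ B (h i) (q i)) (ha : a ∈ U) (hb : b ∈ U)
    {V : ℝ}
    (hi : ∀ i, Integrable (fun x => q i x a * (Real.log (q i x a) - Real.log (q i x b))) μ)
    (hV : ∀ i, ∫ x, q i x a * (Real.log (q i x a) - Real.log (q i x b)) ∂μ ≤ V) :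
    InformationTheory.klDiv (dist μ q n a) (dist μ q n b) ≤ ENNReal.ofReal (n * V) := by
  have hpos := fun (c) (hc : c ∈ U) => jointDensity_pos (n := n) (fun i => (hq i).pos) hc
  have hma := measurable_jointDensity (n := n) hq ha
  have hmb := measurable_jointDensity (n := n) hq hb
  rw [dist, dist, klDiv_withDensity_ofReal hma hmb (hpos a ha) (hpos b hb)
    (lintegral_jointDensity hq ha) (lintegral_jointDensity hq hb)]
  set ν := (Measure.pi fun _ : Fin n => μ).withDensity
    fun y => ENNReal.ofReal (jointDensity q n y a) with hν
  have hνd : ν = dist μ q n a := rfl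
  have hprob : ∀ i : Fin n,
      IsProbabilityMeasure (μ.withDensity fun x => ENNReal.ofReal (q i x a)) := fun i =>
    isProbabilityMeasure_withDensity ((hq i).one a ha)
  have : IsProbabilityMeasure ν := isProbabilityMeasure_withDensity (lintegral_jointDensity hq ha)
  have e1 : ∀ y, jointDensity q n y a * (jointDensity q n y b / jointDensity q n y a) =
      jointDensity q n y b := fun y => mul_div_cancel₀ _ (hpos a ha y).ne'
  have i1 : Integrable (fun y => jointDensity q n y b / jointDensity q n y a) ν := by
    rw [hν, integrable_withDensity_ofReal_iff hma fun y => (hpos a ha y).le]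
    simp only [e1]
    exact integrable_of_lintegral_ofReal_ne_top hmb (fun y => (hpos b hb y).le)
      (by simp [lintegral_jointDensity hq hb])
  have v1 : ∫ y, jointDensity q n y b / jointDensity q n y a ∂ν = 1 := by
    rw [hν, integral_withDensity_ofReal hma fun y => (hpos a ha y).le]
    simp only [e1]
    exact integral_of_lintegral_ofReal_eq_one hmb (fun y => (hpos b hb y).le)
      (lintegral_jointDensity hq hb)
  have i2 : ∀ i : Fin n, Integrable
      (fun y : Fin n → X => Real.log (q i (y i) a) - Real.log (q i (y i) b)) ν := fun i => by
    rw [hνd, dist_eq_pi hq ha]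
    refine integrable_comp_eval (X := fun _ : Fin n => X) (i := i)
      (f := fun x => Real.log (q i x a) - Real.log (q i x b)) ?_
    rw [integrable_withDensity_ofReal_iff ((hq i).meas a ha) fun x => ((hq i).pos x a ha).le]
    exact hi i
  have v2 : ∀ i : Fin n, ∫ y, (Real.log (q i (y i) a) - Real.log (q i (y i) b)) ∂ν ≤ V :=
    fun i => by
    rw [hνd, dist_eq_pi hq ha]
    rw [integral_comp_eval (X := fun _ : Fin n => X) (i := i)
      (f := fun x => Real.log (q i x a) - Real.log (q i x b))
      (((hq i).measurable_log ha).sub ((hq i).measurable_log hb)).aestronglyMeasurable,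
      integral_withDensity_ofReal ((hq i).meas a ha) fun x => ((hq i).pos x a ha).le]
    exact hV i
  have hlog : ∀ y, Real.log (jointDensity q n y b / jointDensity q n y a) =
      -∑ i : Fin n, (Real.log (q i (y i) a) - Real.log (q i (y i) b)) := fun y => by
    rw [Real.log_div (hpos b hb y).ne' (hpos a ha y).ne', log_jointDensity (fun i => (hq i).pos) ha,
      log_jointDensity (fun i => (hq i).pos) hb, Finset.sum_sub_distrib]
    ring
  have i3 : Integrable (fun y : Fin n → X =>
      ∑ i : Fin n, (Real.log (q i (y i) a) - Real.log (q i (y i) b))) ν :=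
    integrable_finsetSum _ fun i _ => i2 i
  have i4 : Integrable
      (fun y => jointDensity q n y b / jointDensity q n y a - 1) ν := i1.sub (integrable_const 1)
  rw [← ofReal_integral_eq_lintegral_ofReal]
  · refine ENNReal.ofReal_le_ofReal ?_
    simp only [hlog, sub_neg_eq_add]
    rw [integral_add i4 i3, integral_sub i1 (integrable_const 1), v1,
      integral_finsetSum _ fun i _ => i2 i]
    have := Finset.sum_le_card_nsmul Finset.univ _ V fun i _ => v2 i
    simpa using this
  · simp only [hlog, sub_neg_eq_add]
    exact i4.add i3
  · refine ae_of_all _ fun y => ?_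
    have := Real.log_le_sub_one_of_pos (div_pos (hpos b hb y) (hpos a ha y))
    simp only [Pi.zero_apply]
    linarith

theorem fisherInfo_apply (hq : ∀ i, IsRegularFamily μ U τ B (h i) (q i)) (hθ : θ ∈ U)
    (hi : ∀ i u v, Integrable (fun x => q i x θ * fderiv ℝ (score (q i) x) θ u v) μ)
    (c d : Fin k) :
    fisherInfo μ q n θ c d = (n : ℝ)⁻¹ * ∑ i : Fin n, -∫ x, q i x θ *
      fderiv ℝ (score (q i) x) θ (EuclideanSpace.single c 1) (EuclideanSpace.single d 1) ∂μ := by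
  have hprob : ∀ i : Fin n,
      IsProbabilityMeasure (μ.withDensity fun x => ENNReal.ofReal (q i x θ)) := fun i =>
    isProbabilityMeasure_withDensity ((hq i).one θ hθ)
  rw [fisherInfo, Matrix.of_apply]
  congr 1
  simp only [iteratedFDeriv_two_log_jointDensity hq hθ]
  rw [integral_neg, Finset.sum_neg_distrib, dist_eq_pi hq hθ, integral_finsetSum]
  · congr 1
    refine Finset.sum_congr rfl fun i _ => ?_
    rw [integral_comp_eval (X := fun _ : Fin n => X) (i := i)
      (f := fun x => fderiv ℝ (score (q i) x) θ (EuclideanSpace.single c 1)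
        (EuclideanSpace.single d 1)) ((hq i).measurable_hessian hθ _ _).aestronglyMeasurable,
      integral_withDensity_ofReal ((hq i).meas θ hθ) fun x => ((hq i).pos x θ hθ).le]
  · intro i _
    refine integrable_comp_eval (X := fun _ : Fin n => X) (i := i)
      (f := fun x => fderiv ℝ (score (q i) x) θ (EuclideanSpace.single c 1)
        (EuclideanSpace.single d 1)) ?_
    rw [integrable_withDensity_ofReal_iff ((hq i).meas θ hθ) fun x => ((hq i).pos x θ hθ).le]
    exact hi i _ _

theorem dotProduct_fisherInfo_mulVec (hq : ∀ i, IsRegularFamily μ U τ B (h i) (q i)) (hθ : θ ∈ U)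
    (hi : ∀ i u v, Integrable (fun x => q i x θ * fderiv ℝ (score (q i) x) θ u v) μ)
    (u : Param k) :
    u.ofLp ⬝ᵥ (fisherInfo μ q n θ).mulVec u.ofLp =
      (n : ℝ)⁻¹ * ∑ i : Fin n, -∫ x, q i x θ * fderiv ℝ (score (q i) x) θ u u ∂μ := by
  have hu : u = ∑ j, u j • EuclideanSpace.single j (1 : ℝ) := by
    ext i
    simp [Finset.sum_apply, Pi.single_apply]
  have hexp : ∀ (i : ℕ) x, q i x θ * fderiv ℝ (score (q i) x) θ u u =
      ∑ c, ∑ d, u c * u d * (q i x θ * fderiv ℝ (score (q i) x) θ (EuclideanSpace.single c 1)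
        (EuclideanSpace.single d 1)) := fun i x => by
    conv_lhs => rw [hu]
    simp only [map_sum, map_smul, _root_.sum_apply, _root_.smul_apply, smul_eq_mul,
      Finset.mul_sum]
    rw [Finset.sum_comm]
    refine Finset.sum_congr rfl fun c _ => Finset.sum_congr rfl fun d _ => ?_
    ring
  have hint : ∀ i : ℕ, ∫ x, q i x θ * fderiv ℝ (score (q i) x) θ u u ∂μ =
      ∑ c, ∑ d, u c * u d * ∫ x, q i x θ * fderiv ℝ (score (q i) x) θ
        (EuclideanSpace.single c 1) (EuclideanSpace.single d 1) ∂μ := fun i => by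
    simp only [hexp]
    rw [integral_finsetSum _ fun c _ => integrable_finsetSum _ fun d _ => (hi i _ _).const_mul _]
    refine Finset.sum_congr rfl fun c _ => ?_
    rw [integral_finsetSum _ fun d _ => (hi i _ _).const_mul _]
    exact Finset.sum_congr rfl fun d _ => integral_const_mul _ _
  simp only [hint, dotProduct, Matrix.mulVec, fisherInfo_apply hq hθ hi, Finset.mul_sum,
    Finset.sum_mul, ← Finset.sum_neg_distrib]
  conv_rhs => rw [Finset.sum_comm]
  refine Finset.sum_congr rfl fun c _ => ?_
  conv_rhs => rw [Finset.sum_comm]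
  refine Finset.sum_congr rfl fun d _ => Finset.sum_congr rfl fun i _ => ?_
  ring

end Product

/-! ### Coverings and lattices in the parameter space -/

theorem norm_le_sum_abs {k : ℕ} (u : Param k) : ‖u‖ ≤ ∑ j, |u j| := by
  have hu : u = ∑ j, u j • EuclideanSpace.single j (1 : ℝ) := by
    ext i
    simp [Finset.sum_apply, Pi.single_apply]
  conv_lhs => rw [hu]
  refine (norm_sum_le _ _).trans (Finset.sum_le_sum fun j _ => ?_)
  rw [norm_smul, Real.norm_eq_abs]
  simp

/-- A subset of a ball of radius `ρ` in `ℝ^k` is covered by `O((ρ / r + 1) ^ k)` balls of radius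
`r` with centres in the subset. -/
theorem exists_finset_cover {k : ℕ} {A : Set (Param k)} {x₀ : Param k} {ρ r : ℝ} (hr : 0 < r)
    (hρ : 0 ≤ ρ) (hA : A ⊆ Metric.closedBall x₀ ρ) :
    ∃ S : Finset (Param k), (S : Set (Param k)) ⊆ A ∧
      (∀ x ∈ A, ∃ s ∈ S, x ∈ Metric.closedBall s r) ∧
      (S.card : ℝ) ≤ (2 * (k + 1) * (ρ / r) + 3) ^ k := by
  classical
  -- Cell width of a cubic grid: two points of one cell are at distance at most `k * w ≤ r`; `k + 1`
  -- avoids division by zero.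
  set w : ℝ := r / (k + 1) with hw
  have hw0 : 0 < w := by positivity
  let f : Param k → Fin k → ℤ := fun x j => ⌊(x j - x₀ j) / w⌋
  set m : ℕ := ⌈ρ / w⌉₊ with hm
  set P : Finset (Fin k → ℤ) := Fintype.piFinset fun _ => Finset.Icc (-(m : ℤ)) m with hP
  have hfP : ∀ x ∈ A, f x ∈ P := fun x hx => by
    rw [hP, Fintype.mem_piFinset]
    intro j
    have h1 : |x j - x₀ j| ≤ ρ := by
      have := PiLp.norm_apply_le (x - x₀) j
      rw [Real.norm_eq_abs, PiLp.sub_apply] at this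
      exact this.trans (mem_closedBall_iff_norm.1 (hA hx))
    have h2 : |(x j - x₀ j) / w| ≤ m := by
      rw [abs_div, abs_of_pos hw0]
      exact (div_le_div_of_nonneg_right h1 hw0.le).trans (Nat.le_ceil _)
    rw [abs_le] at h2
    rw [Finset.mem_Icc]
    refine ⟨Int.le_floor.2 (by push_cast; exact h2.1), ?_⟩
    have h3 : ((f x j : ℤ) : ℝ) ≤ ((m : ℤ) : ℝ) := (Int.floor_le _).trans (by exact_mod_cast h2.2)
    exact_mod_cast h3
  -- One point of `A` is chosen in every occupied cell; empty cells get the dummy `x₀` and are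
  -- filtered out below.
  have hch : ∀ z : Fin k → ℤ, ∃ x : Param k, (∃ y ∈ A, f y = z) → x ∈ A ∧ f x = z := fun z => by
    by_cases hz : ∃ y ∈ A, f y = z
    · obtain ⟨y, hy, hyz⟩ := hz
      exact ⟨y, fun _ => ⟨hy, hyz⟩⟩
    · exact ⟨x₀, fun hz' => absurd hz' hz⟩
  choose g hg using hch
  refine ⟨(P.filter fun z => ∃ y ∈ A, f y = z).image g, ?_, fun x hx => ?_, ?_⟩
  · intro x hx
    obtain ⟨z, hz, rfl⟩ := Finset.mem_image.1 (Finset.mem_coe.1 hx)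
    exact (hg z (Finset.mem_filter.1 hz).2).1
  · refine ⟨g (f x), Finset.mem_image_of_mem _ (Finset.mem_filter.2 ⟨hfP x hx, x, hx, rfl⟩), ?_⟩
    have h1 := (hg (f x) ⟨x, hx, rfl⟩).2
    rw [mem_closedBall_iff_norm]
    have h2 : ∀ j, |(x - g (f x)) j| ≤ w := fun j => by
      have h3 : ⌊((g (f x)) j - x₀ j) / w⌋ = ⌊(x j - x₀ j) / w⌋ := congrFun h1 j
      have h4 := Int.abs_sub_lt_one_of_floor_eq_floor h3
      rw [← sub_div, abs_div, abs_of_pos hw0, div_lt_one hw0] at h4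
      rw [PiLp.sub_apply, abs_sub_comm]
      have h5 : (g (f x)) j - x₀ j - (x j - x₀ j) = (g (f x)) j - x j := by ring
      rw [h5] at h4
      exact h4.le
    calc ‖x - g (f x)‖ ≤ ∑ j, |(x - g (f x)) j| := norm_le_sum_abs _
      _ ≤ k * w := by
        have := Finset.sum_le_card_nsmul Finset.univ _ w fun j _ => h2 j
        simpa using this
      _ ≤ r := by
        rw [hw, mul_div_assoc', div_le_iff₀ (by positivity)]
        nlinarith
  · have h1 : ((P.filter fun z => ∃ y ∈ A, f y = z).image g).card ≤ (2 * m + 1) ^ k := by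
      refine Finset.card_image_le.trans ((Finset.card_filter_le _ _).trans ?_)
      rw [hP, Fintype.card_piFinset]
      simp only [Int.card_Icc, Finset.prod_const, Finset.card_univ, Fintype.card_fin]
      refine Nat.pow_le_pow_left ?_ k
      omega
    calc _ ≤ (((2 * m + 1) ^ k : ℕ) : ℝ) := by exact_mod_cast h1
      _ = (2 * (m : ℝ) + 1) ^ k := by push_cast; ring
      _ ≤ _ := by
        refine pow_le_pow_left₀ (by positivity) ?_ k
        have h2 : (m : ℝ) < ρ / w + 1 := Nat.ceil_lt_add_one (by positivity)
        have h3 : ρ / w = (k + 1) * (ρ / r) := by rw [hw]; field_simp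
        rw [h3] at h2
        linarith

/-- A finite set of vectors on which every linear functional exceeds its maximum over the unit
ball. -/
theorem exists_finset_norming (k : ℕ) :
    ∃ S : Finset (Param k), (∀ v ∈ S, ‖v‖ ≤ 2) ∧
      ∀ (L : Param k →L[ℝ] ℝ) (u : Param k), ‖u‖ ≤ 1 → ∃ v ∈ S, L u ≤ L v := by
  classical
  obtain ⟨S, hS, hcov, -⟩ := exists_finset_cover (A := Metric.closedBall (0 : Param k) 1)
    (x₀ := 0) (ρ := 1) (r := 1 / 2) (by norm_num) zero_le_one le_rfl
  refine ⟨S.image fun v => (2 : ℝ) • v, fun v hv => ?_, fun L u hu => ?_⟩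
  · obtain ⟨s, hs, rfl⟩ := Finset.mem_image.1 hv
    have := mem_closedBall_zero_iff.1 (hS (Finset.mem_coe.2 hs))
    rw [norm_smul, Real.norm_two]
    linarith
  · obtain ⟨u₀, hu₀, hmax⟩ := (isCompact_closedBall (0 : Param k) 1).exists_isMaxOn
      ⟨0, Metric.mem_closedBall_self zero_le_one⟩ L.continuous.continuousOn
    obtain ⟨s, hs, hus⟩ := hcov u₀ hu₀
    refine ⟨(2 : ℝ) • s, Finset.mem_image_of_mem _ hs, ?_⟩
    have h1 : L u ≤ L u₀ := hmax (mem_closedBall_zero_iff.2 hu)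
    -- As `s` is within `1/2` of the maximiser `u₀`, the vector `2 (u₀ - s)` is again in the unit
    -- ball; rearranging gives `L u₀ ≤ L (2 s)`.
    have h2 : L ((2 : ℝ) • (u₀ - s)) ≤ L u₀ := by
      refine hmax (mem_closedBall_zero_iff.2 ?_)
      rw [norm_smul, Real.norm_two]
      linarith [mem_closedBall_iff_norm.1 hus]
    rw [map_smul, map_sub, smul_eq_mul] at h2
    rw [map_smul, smul_eq_mul]
    linarith

theorem exists_forall_mul_sq_norm_le_of_posDef {k : ℕ} {J : Matrix (Fin k) (Fin k) ℝ}
    (hJ : J.PosDef) : ∃ l > 0, ∀ u : Param k, l * ‖u‖ ^ 2 ≤ u.ofLp ⬝ᵥ J.mulVec u.ofLp := by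
  have hcont : Continuous fun u : Param k => u.ofLp ⬝ᵥ J.mulVec u.ofLp := by
    have h1 : Continuous fun u : Param k => u.ofLp := PiLp.continuous_ofLp 2 _
    exact h1.dotProduct (Continuous.matrix_mulVec continuous_const h1)
  -- The sphere is empty exactly for `k = 0`; otherwise the minimum of the form on it is the
  -- constant.
  rcases (Metric.sphere (0 : Param k) 1).eq_empty_or_nonempty with he | hne
  · refine ⟨1, one_pos, fun u => ?_⟩
    have hu : u = 0 := by
      by_contra hu
      have : (‖u‖⁻¹ • u) ∈ Metric.sphere (0 : Param k) 1 := by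
        rw [mem_sphere_zero_iff_norm, norm_smul, norm_inv, norm_norm,
          inv_mul_cancel₀ (norm_ne_zero_iff.2 hu)]
      rw [he] at this
      exact this
    simp [hu]
  · obtain ⟨u₀, hu₀, hmin⟩ := (isCompact_sphere (0 : Param k) 1).exists_isMinOn hne
      hcont.continuousOn
    have hu₀1 := mem_sphere_zero_iff_norm.1 hu₀
    have hne0 : u₀.ofLp ≠ 0 := fun h0 => by
      have : u₀ = 0 := by ext i; exact congrFun h0 i
      rw [this, norm_zero] at hu₀1
      exact zero_ne_one hu₀1
    refine ⟨u₀.ofLp ⬝ᵥ J.mulVec u₀.ofLp, by simpa using hJ.dotProduct_mulVec_pos hne0, fun u => ?_⟩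
    by_cases hu : u = 0
    · simp [hu]
    have hn := norm_ne_zero_iff.2 hu
    have hs : (‖u‖⁻¹ • u) ∈ Metric.sphere (0 : Param k) 1 := by
      rw [mem_sphere_zero_iff_norm, norm_smul, norm_inv, norm_norm, inv_mul_cancel₀ hn]
    have h1 : u₀.ofLp ⬝ᵥ J.mulVec u₀.ofLp ≤
        (‖u‖⁻¹ • u).ofLp ⬝ᵥ J.mulVec (‖u‖⁻¹ • u).ofLp := hmin hs
    rw [WithLp.ofLp_smul, Matrix.mulVec_smul, dotProduct_smul, smul_dotProduct, smul_eq_mul,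
      smul_eq_mul] at h1
    calc _ ≤ ‖u‖⁻¹ * (‖u‖⁻¹ * u.ofLp ⬝ᵥ J.mulVec u.ofLp) * ‖u‖ ^ 2 := by gcongr
      _ = _ := by field_simp

theorem eventually_mul_sq_norm_le {k : ℕ} {J : Matrix (Fin k) (Fin k) ℝ} (hJ : J.PosDef)
    {F : ℕ → Matrix (Fin k) (Fin k) ℝ} (hF : Tendsto F atTop (𝓝 J)) :
    ∃ l > 0, ∀ᶠ n in atTop, ∀ u : Param k, l * ‖u‖ ^ 2 ≤ u.ofLp ⬝ᵥ (F n).mulVec u.ofLp := by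
  obtain ⟨l, hl, hJl⟩ := exists_forall_mul_sq_norm_le_of_posDef hJ
  refine ⟨l / 2, by positivity, ?_⟩
  have h0 : Tendsto (fun n => ∑ i, ∑ j, |F n i j - J i j|) atTop (𝓝 0) := by
    have : Tendsto (fun n => ∑ i, ∑ j, |F n i j - J i j|) atTop
        (𝓝 (∑ i : Fin k, ∑ j : Fin k, |J i j - J i j|)) := by
      refine tendsto_finsetSum _ fun i _ => tendsto_finsetSum _ fun j _ => ?_
      exact (((tendsto_pi_nhds.1 (tendsto_pi_nhds.1 hF i) j)).sub_const _).abs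
    simpa using this
  filter_upwards [h0.eventually_le_const (show (0 : ℝ) < l / 2 by positivity)] with n hn u
  have h1 : u.ofLp ⬝ᵥ J.mulVec u.ofLp - u.ofLp ⬝ᵥ (F n).mulVec u.ofLp ≤
      (∑ i, ∑ j, |F n i j - J i j|) * ‖u‖ ^ 2 := by
    simp only [dotProduct, Matrix.mulVec, Finset.mul_sum, Finset.sum_mul, ← Finset.sum_sub_distrib]
    refine Finset.sum_le_sum fun i _ => Finset.sum_le_sum fun j _ => ?_
    have e1 := PiLp.norm_apply_le u i
    have e2 := PiLp.norm_apply_le u j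
    rw [Real.norm_eq_abs] at e1 e2
    calc u i * (J i j * u j) - u i * (F n i j * u j) = (J i j - F n i j) * (u i * u j) := by ring
      _ ≤ |(J i j - F n i j) * (u i * u j)| := le_abs_self _
      _ = |F n i j - J i j| * (|u i| * |u j|) := by rw [abs_mul, abs_mul, abs_sub_comm]
      _ ≤ |F n i j - J i j| * (‖u‖ * ‖u‖) := by gcongr
      _ = _ := by ring
  have h2 := mul_le_mul_of_nonneg_right hn (sq_nonneg ‖u‖)
  have h3 := hJl u
  linarith

theorem summable_exp_neg_mul_sq_int {c : ℝ} (hc : 0 < c) :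
    Summable fun d : ℤ => Real.exp (-c * (d : ℝ) ^ 2) := by
  have h1 : Summable fun n : ℕ => Real.exp (-c * (n : ℝ) ^ 2) := by
    refine Summable.of_nonneg_of_le (fun _ => (Real.exp_pos _).le) (fun n => ?_)
      (Real.summable_exp_nat_mul_iff.2 (neg_lt_zero.2 hc))
    refine Real.exp_le_exp.2 ?_
    rcases Nat.eq_zero_or_pos n with rfl | hn
    · simp
    · have : (1 : ℝ) ≤ n := by exact_mod_cast hn
      nlinarith [mul_pos hc (by linarith : (0 : ℝ) < n)]
  refine Summable.of_nat_of_neg (by simpa using h1) (by simpa using h1)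

/-- The differences `a - l` are distinct integers, so the bound is uniform in `a` and `M`. -/
theorem sum_exp_neg_mul_sq_le {c : ℝ} (hc : 0 < c) (M a : ℕ) :
    ∑ l ∈ Finset.range M, Real.exp (-c * ((a : ℝ) - l) ^ 2) ≤
      ∑' d : ℤ, Real.exp (-c * (d : ℝ) ^ 2) := by
  have hinj : Function.Injective fun l : ℕ => (a : ℤ) - l := fun l l' hl => by
    simpa using hl
  have h1 := (summable_exp_neg_mul_sq_int hc).sum_le_tsum
    ((Finset.range M).map ⟨_, hinj⟩) fun _ _ => (Real.exp_pos _).le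
  rw [Finset.sum_map] at h1
  simpa using h1

theorem tsum_exp_neg_mul_sq_pos {c : ℝ} (hc : 0 < c) :
    0 < ∑' d : ℤ, Real.exp (-c * (d : ℝ) ^ 2) :=
  (summable_exp_neg_mul_sq_int hc).tsum_pos (fun _ => (Real.exp_pos _).le) 0 (Real.exp_pos _)

/-! ### Local Hellinger separation, compactness, and the mass of a ball of radius `1 / √n`. -/

section Uniform

variable {X : Type*} [MeasurableSpace X] {k : ℕ} {μ : Measure X} [SigmaFinite μ]
  {U : Set (Param k)} {τ B : ℝ} {h : ℕ → X → ℝ} {q : ℕ → X → Param k → ℝ} {δ : ℝ}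

/-- Summing the single-observation bound turns the score terms into `n` times the Fisher quadratic
form at the centre, eventually at least `l ‖a - b‖²`. Of the resulting `l / 16`, the radius is
chosen so that the error costs at most `l / 32`. -/
theorem exists_local_hellinger (hδ : 0 < δ) (hτ : 0 < τ)
    (hq : ∀ i, IsRegularFamily μ U τ B (h i) (q i)) {θ : Param k}
    (hθδ : Metric.closedBall θ δ ⊆ U) {J : Matrix (Fin k) (Fin k) ℝ} (hJ : J.PosDef)
    (hlim : Tendsto (fun n : ℕ => fisherInfo μ q n θ) atTop (𝓝 J)) :
    ∃ r > 0, ∃ c > 0, ∃ N : ℕ, ∀ n ≥ N, ∀ a ∈ Metric.closedBall θ r,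
      ∀ b ∈ Metric.closedBall θ r,
        n * c * ‖a - b‖ ^ 2 ≤ ∑ i : Fin n, (1 - affinity μ (q i) a b) := by
  obtain ⟨σ, hσ, C, hC0, hC⟩ :=
    IsRegularFamily.exists_exp_envelope_le (μ := μ) (U := U) (B := B) hδ hτ
  obtain ⟨η, hη, A, hA0, hA⟩ :=
    IsRegularFamily.exists_le_one_sub_affinity (μ := μ) (U := U) (B := B) hδ hτ
  have hθ : θ ∈ U := hθδ (Metric.mem_closedBall_self hδ.le)
  have hi := fun i => (hC (h i) (q i) (hq i) θ hθδ).1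
  obtain ⟨l, hl, hev⟩ := eventually_mul_sq_norm_le hJ hlim
  obtain ⟨N, hN⟩ := eventually_atTop.1 hev
  obtain ⟨r, hr0, hrη, hrA⟩ : ∃ r > 0, r ≤ η ∧ A * r ^ 2 ≤ l / 32 := by
    refine ⟨min η (min 1 (l / (32 * (A + 1)))), by positivity, min_le_left _ _, ?_⟩
    set r := min η (min 1 (l / (32 * (A + 1))))
    have h0 : 0 < r := by positivity
    have h1 : r ≤ 1 := (min_le_right _ _).trans (min_le_left _ _)
    have h2 : r ≤ l / (32 * (A + 1)) := (min_le_right _ _).trans (min_le_right _ _)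
    rw [le_div_iff₀ (by positivity)] at h2
    have h3 : r ^ 2 ≤ r := by nlinarith
    have h4 : A * r ^ 2 ≤ A * r := mul_le_mul_of_nonneg_left h3 hA0
    nlinarith
  refine ⟨r, hr0, l / 32, by positivity, max N 1, fun n hn a ha b hb => ?_⟩
  have hn1 : 1 ≤ n := (le_max_right _ _).trans hn
  have hn0 : (0 : ℝ) < n := by exact_mod_cast hn1
  have h1 := hN n ((le_max_left _ _).trans hn) (a - b)
  rw [dotProduct_fisherInfo_mulVec hq hθ
    fun i u v => (hq i).integrable_hessian hθ hσ (hi i) u v] at h1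
  have hid : ∀ i, -∫ x, q i x θ * fderiv ℝ (score (q i) x) θ (a - b) (a - b) ∂μ =
      ∫ x, q i x θ * score (q i) x θ (a - b) ^ 2 ∂μ := fun i => by
    have h2 := (hq i).integral_score_sq_add_hessian hδ hθδ hσ (hi i) (a - b)
    simp only [mul_add] at h2
    rw [integral_add ((hq i).integrable_score_sq hθ hσ (hi i) _)
      ((hq i).integrable_hessian hθ hσ (hi i) _ _)] at h2
    linarith
  simp only [hid] at h1
  rw [← div_eq_inv_mul, le_div_iff₀ hn0] at h1
  have h3 := Finset.sum_le_sum fun (i : Fin n) (_ : i ∈ Finset.univ) =>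
    hA (h i) (q i) (hq i) θ hθδ r hrη a ha b hb
  rw [Finset.sum_sub_distrib, ← Finset.sum_div, Finset.sum_const, Finset.card_univ,
    Fintype.card_fin, nsmul_eq_mul] at h3
  have h4 : A * r ^ 2 * (n * ‖a - b‖ ^ 2) ≤ l / 32 * (n * ‖a - b‖ ^ 2) :=
    mul_le_mul_of_nonneg_right hrA (by positivity)
  linarith

/-- The parameter set is a finite union of sets on which the Hellinger distance dominates the
Euclidean distance. -/
theorem exists_finset_hellinger (hδ : 0 < δ) (hτ : 0 < τ)
    (hq : ∀ i, IsRegularFamily μ U τ B (h i) (q i)) {Θ : Set (Param k)} (hΘ : IsCompact Θ)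
    (hΘδ : ∀ θ ∈ Θ, Metric.closedBall θ δ ⊆ U) {J : Param k → Matrix (Fin k) (Fin k) ℝ}
    (hJ : ∀ θ ∈ Θ, (J θ).PosDef)
    (hlim : ∀ θ ∈ Θ, Tendsto (fun n : ℕ => fisherInfo μ q n θ) atTop (𝓝 (J θ))) :
    ∃ F : Finset (Set (Param k)), ∃ c > 0, ∃ N : ℕ, (∀ θ ∈ Θ, ∃ S ∈ F, θ ∈ S) ∧
      ∀ S ∈ F, ∀ n ≥ N, ∀ a ∈ S, ∀ b ∈ S,
        n * c * ‖a - b‖ ^ 2 ≤ ∑ i : Fin n, (1 - affinity μ (q i) a b) := by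
  classical
  -- Pairs `a`, `b` are compared only within one piece, so no separation of distant parameters is
  -- required.
  refine hΘ.induction_on (p := fun s => ∃ F : Finset (Set (Param k)), ∃ c > 0, ∃ N : ℕ,
    (∀ θ ∈ s, ∃ S ∈ F, θ ∈ S) ∧ ∀ S ∈ F, ∀ n ≥ N, ∀ a ∈ S, ∀ b ∈ S,
      n * c * ‖a - b‖ ^ 2 ≤ ∑ i : Fin n, (1 - affinity μ (q i) a b)) ?_ ?_ ?_ ?_
  · exact ⟨∅, 1, one_pos, 0, by simp, by simp⟩
  · rintro s t hst ⟨F, c, hc, N, h1, h2⟩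
    exact ⟨F, c, hc, N, fun θ hθ => h1 θ (hst hθ), h2⟩
  · rintro s t ⟨F, c, hc, N, h1, h2⟩ ⟨F', c', hc', N', h1', h2'⟩
    refine ⟨F ∪ F', min c c', lt_min hc hc', max N N', ?_, ?_⟩
    · rintro θ (hθ | hθ)
      · obtain ⟨S, hS, hθS⟩ := h1 θ hθ
        exact ⟨S, Finset.mem_union_left _ hS, hθS⟩
      · obtain ⟨S, hS, hθS⟩ := h1' θ hθ
        exact ⟨S, Finset.mem_union_right _ hS, hθS⟩
    · intro S hS n hn a ha b hb
      rcases Finset.mem_union.1 hS with hS | hS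
      · refine le_trans ?_ (h2 S hS n ((le_max_left _ _).trans hn) a ha b hb)
        gcongr
        exact min_le_left _ _
      · refine le_trans ?_ (h2' S hS n ((le_max_right _ _).trans hn) a ha b hb)
        gcongr
        exact min_le_right _ _
  · intro θ hθ
    obtain ⟨r, hr, c, hc, N, hN⟩ :=
      exists_local_hellinger hδ hτ hq (hΘδ θ hθ) (hJ θ hθ) (hlim θ hθ)
    exact ⟨Metric.closedBall θ r, mem_nhdsWithin_of_mem_nhds (Metric.closedBall_mem_nhds θ hr),
      {Metric.closedBall θ r}, c, hc, N, by simp, by simpa using hN⟩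

/-- The data whose estimate lies in a ball of radius `n ^ (-1 / 2)` carry bounded mass. -/
theorem exists_setLIntegral_ball_le (hδ : 0 < δ) (hτ : 0 < τ)
    (hq : ∀ i, IsRegularFamily μ U τ B (h i) (q i)) :
    ∃ A : ℝ, 0 ≤ A ∧ ∃ N : ℕ, ∀ n ≥ N, ∀ t, Metric.closedBall t δ ⊆ U →
      ∀ m : (Fin n → X) → Param k,
        ∫⁻ y in {y | m y ∈ Metric.closedBall t (√n)⁻¹}, ENNReal.ofReal (jointDensity q n y (m y))
          ∂(Measure.pi fun _ : Fin n => μ) ≤ ENNReal.ofReal A := by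
  obtain ⟨S, hS2, hS⟩ := exists_finset_norming k
  have hlim : Tendsto (fun n : ℕ => (√(n : ℝ))⁻¹) atTop (𝓝 0) :=
    (Real.tendsto_sqrt_atTop.comp tendsto_natCast_atTop_atTop).inv_tendsto_atTop
  have hev := (hlim.eventually_le_const (show (0 : ℝ) < min (δ / 2) (√τ / 3) by positivity)).and
    (eventually_ge_atTop 1)
  obtain ⟨N, hN⟩ := eventually_atTop.1 hev
  refine ⟨S.card * Real.exp (9 / τ * |B|), by positivity, N, fun n hn t ht m => ?_⟩
  obtain ⟨hrle, hn1⟩ := hN n hn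
  have hn0 : (0 : ℝ) < n := by exact_mod_cast hn1
  set r : ℝ := (√n)⁻¹ with hr
  have hr0 : 0 < r := by positivity
  have hr2 : r ^ 2 = (n : ℝ)⁻¹ := by rw [hr, inv_pow, Real.sq_sqrt hn0.le]
  have hrδ : 2 * r ≤ δ := by linarith [hrle.trans (min_le_left _ _)]
  -- The estimate is within `r` of `t` and the comparison point `t + r • v` within `2 r`, so their
  -- squared distance is at most `(3 r)² = 9 / n`.
  set s : ℝ := 9 * r ^ 2 with hs
  have hsτ : s ≤ τ := by
    have h1 : 3 * r ≤ √τ := by linarith [hrle.trans (min_le_right _ _)]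
    have h2 : (3 * r) ^ 2 ≤ √τ ^ 2 := by gcongr
    rw [Real.sq_sqrt hτ.le] at h2
    rw [hs]; linarith
  have hcv := convex_closedBall t δ
  have hmemv : ∀ v ∈ S, t + r • v ∈ Metric.closedBall t δ := fun v hv => by
    rw [mem_closedBall_iff_norm, add_sub_cancel_left, norm_smul, Real.norm_of_nonneg hr0.le]
    have := mul_le_mul_of_nonneg_left (hS2 v hv) hr0.le
    linarith
  have hmeas : ∀ v ∈ S, ∀ i : ℕ, Measurable fun x =>
      ENNReal.ofReal (q i x (t + r • v) * Real.exp (s * h i x)) := fun v hv i =>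
    (((hq i).meas _ (ht (hmemv v hv))).mul
      (Real.measurable_exp.comp ((hq i).h_meas.const_mul s))).ennreal_ofReal
  have hpt : ∀ y ∈ {y | m y ∈ Metric.closedBall t r}, ENNReal.ofReal (jointDensity q n y (m y)) ≤
      ∑ v ∈ S, ∏ i : Fin n,
        ENNReal.ofReal (q i (y i) (t + r • v) * Real.exp (s * h i (y i))) := by
    intro y hy
    have hy' : ‖m y - t‖ ≤ r := mem_closedBall_iff_norm.1 hy
    have hmy : m y ∈ Metric.closedBall t δ := mem_closedBall_iff_norm.2 (by linarith)
    obtain ⟨v, hv, hle⟩ := hS (∑ i : Fin n, score (q i) (y i) (m y)) (r⁻¹ • (m y - t)) (by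
      rw [norm_smul, norm_inv, Real.norm_of_nonneg hr0.le, inv_mul_le_iff₀ hr0]
      linarith)
    refine le_trans ?_ (Finset.single_le_sum
      (f := fun v => ∏ i : Fin n,
        ENNReal.ofReal (q i (y i) (t + r • v) * Real.exp (s * h i (y i))))
      (fun _ _ => zero_le) hv)
    have hnonneg : ∀ i : Fin n, 0 ≤ q i (y i) (t + r • v) * Real.exp (s * h i (y i)) := fun i =>
      mul_nonneg ((hq i).pos _ _ (ht (hmemv v hv))).le (Real.exp_pos _).le
    rw [← ENNReal.ofReal_prod_of_nonneg fun i _ => hnonneg i]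
    refine ENNReal.ofReal_le_ofReal ?_
    set w := t + r • v with hw
    -- `v` was chosen so that the gradient at `m y` does not point away from `w`. Moving from `m y`
    -- to `w` thus costs only the second-order error `s * h i`; stationarity of `m y` plays no role.
    have hgrad : 0 ≤ ∑ i : Fin n, score (q i) (y i) (m y) (w - m y) := by
      have e : w - m y = r • (v - r⁻¹ • (m y - t)) := by
        rw [smul_sub, smul_smul, mul_inv_cancel₀ hr0.ne', one_smul, hw]
        abel
      rw [← _root_.sum_apply, e, map_smul, map_sub, smul_eq_mul]
      exact mul_nonneg hr0.le (sub_nonneg.2 hle)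
    have hwm : ‖w - m y‖ ^ 2 ≤ s := by
      have h1 : ‖w - m y‖ ≤ 3 * r := by
        have e : w - m y = r • v - (m y - t) := by rw [hw]; abel
        rw [e]
        refine (norm_sub_le _ _).trans ?_
        rw [norm_smul, Real.norm_of_nonneg hr0.le]
        have := mul_le_mul_of_nonneg_left (hS2 v hv) hr0.le
        linarith
      calc ‖w - m y‖ ^ 2 ≤ (3 * r) ^ 2 := by gcongr
        _ = s := by rw [hs]; ring
    have hsum : ∑ i : Fin n, Real.log (q i (y i) (m y)) ≤
        ∑ i : Fin n, (Real.log (q i (y i) w) + s * h i (y i)) := by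
      have h1 : ∀ i : Fin n, Real.log (q i (y i) (m y)) + score (q i) (y i) (m y) (w - m y) ≤
          Real.log (q i (y i) w) + s * h i (y i) := fun i => by
        have h2 := (abs_le.1 ((hq i).abs_log_sub_sub_score_le hcv ht hmy (hmemv v hv) (y i))).1
        have h3 := mul_le_mul_of_nonneg_left hwm ((hq i).h_nonneg (ht hmy) (y i))
        linarith
      have h4 := Finset.sum_le_sum fun (i : Fin n) (_ : i ∈ Finset.univ) => h1 i
      rw [Finset.sum_add_distrib] at h4
      linarith
    calc jointDensity q n y (m y) = Real.exp (∑ i : Fin n, Real.log (q i (y i) (m y))) := by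
          rw [← log_jointDensity (fun i => (hq i).pos) (ht hmy),
            Real.exp_log (jointDensity_pos (fun i => (hq i).pos) (ht hmy) y)]
      _ ≤ Real.exp (∑ i : Fin n, (Real.log (q i (y i) w) + s * h i (y i))) :=
          Real.exp_le_exp.2 hsum
      _ = _ := by
          rw [Real.exp_sum]
          refine Finset.prod_congr rfl fun i _ => ?_
          rw [Real.exp_add, Real.exp_log ((hq i).pos _ _ (ht (hmemv v hv)))]
  have hmeas' : ∀ v ∈ S, Measurable fun y : Fin n → X => ∏ i : Fin n,
      ENNReal.ofReal (q i (y i) (t + r • v) * Real.exp (s * h i (y i))) := fun v hv =>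
    Finset.measurable_fun_prod _ fun i _ => (hmeas v hv i).comp (measurable_pi_apply i)
  refine (setLIntegral_mono (Finset.measurable_fun_sum _ hmeas') hpt).trans ?_
  refine (setLIntegral_le_lintegral _ _).trans ?_
  rw [lintegral_finsetSum' _ fun v hv => (hmeas' v hv).aemeasurable]
  have hv : ∀ v ∈ S, ∫⁻ y, ∏ i : Fin n,
      ENNReal.ofReal (q i (y i) (t + r • v) * Real.exp (s * h i (y i)))
        ∂(Measure.pi fun _ : Fin n => μ) ≤ ENNReal.ofReal (Real.exp (9 / τ * |B|)) := by
    intro v hv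
    rw [lintegral_pi_prod (fun _ : Fin n => μ)
      (fun i x => ENNReal.ofReal (q i x (t + r • v) * Real.exp (s * h i x)))
      fun i => hmeas v hv i]
    calc _ ≤ ∏ _i : Fin n, ENNReal.ofReal (Real.exp (s / τ * |B|)) :=
          Finset.prod_le_prod' fun i _ => (hq i).lintegral_exp_mul_le hτ (ht (hmemv v hv))
            (by positivity) hsτ
      _ = ENNReal.ofReal (Real.exp (9 / τ * |B|)) := by
          rw [Finset.prod_const, Finset.card_univ, Fintype.card_fin,
            ← ENNReal.ofReal_pow (Real.exp_pos _).le, ← Real.exp_nat_mul]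
          congr 2
          rw [hs, hr2]
          field_simp
  refine (Finset.sum_le_card_nsmul _ _ _ hv).trans ?_
  rw [nsmul_eq_mul, ENNReal.ofReal_mul (by positivity), ENNReal.ofReal_natCast]

end Uniform

/-! ### The counting theorem -/

/-- Uses only monotonicity and countable subadditivity, so neither the sets nor the integrand need
be measurable; this allows Kullback-Leibler balls and arbitrary pieces. -/
theorem setLIntegral_le_card_mul {Y ι : Type*} [MeasurableSpace Y] {m : Measure Y} {A : Set Y}
    {g : Y → ℝ≥0∞} (T : Finset ι) (s : ι → Set Y) (hA : ∀ y ∈ A, ∃ t ∈ T, y ∈ s t) {C : ℝ≥0∞}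
    (hC : ∀ t ∈ T, ∫⁻ y in s t, g y ∂m ≤ C) : ∫⁻ y in A, g y ∂m ≤ T.card * C := by
  have hsub : A ⊆ ⋃ t : T, s t := fun y hy => by
    obtain ⟨t, ht, hyt⟩ := hA y hy
    exact Set.mem_iUnion.2 ⟨⟨t, ht⟩, hyt⟩
  refine (lintegral_mono_set hsub).trans ((lintegral_iUnion_le _ _).trans ?_)
  rw [tsum_fintype, Finset.sum_coe_sort T fun t => ∫⁻ y in s t, g y ∂m, ← nsmul_eq_mul]
  exact Finset.sum_le_card_nsmul _ _ _ hC

theorem complexity_eq_lintegral {X : Type*} [MeasurableSpace X] {k : ℕ} (μ : Measure X)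
    {q : ℕ → X → Param k → ℝ} {Θ : Set (Param k)} {mle : (n : ℕ) → (Fin n → X) → Param k}
    (h_mle : IsMLE q Θ mle) (n : ℕ) :
    complexity μ q Θ n = ∫⁻ y, ENNReal.ofReal (jointDensity q n y (mle n y))
      ∂(Measure.pi fun _ : Fin n => μ) := by
  refine lintegral_congr fun y => le_antisymm (iSup₂_le fun θ hθ => ?_) ?_
  · exact ENNReal.ofReal_le_ofReal (h_mle.isMax n y θ hθ)
  · exact le_iSup₂_of_le (mle n y) (h_mle.mem n y) le_rfl

section Counting

variable {X : Type*} [MeasurableSpace X] {k : ℕ} {μ : Measure X}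
  {U : Set (Param k)} {τ B : ℝ} {h : ℕ → X → ℝ} {q : ℕ → X → Param k → ℝ} {δ : ℝ}
  {Θ : Set (Param k)} {mle : (n : ℕ) → (Fin n → X) → Param k}

theorem klDiv_le_of_mem_klBall {n : ℕ} (hn : n ≠ 0) {ε : ℝ} {θ₀ θ : Param k}
    (hθ : θ ∈ klBall μ q Θ n ε θ₀) :
    InformationTheory.klDiv (dist μ q n θ₀) (dist μ q n θ) ≤ ENNReal.ofReal (n * ε ^ 2) := by
  have h1 := hθ.2
  rw [normalizedKL, ENNReal.div_le_iff_le_mul (Or.inl (by exact_mod_cast hn))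
    (Or.inl (ENNReal.natCast_ne_top n))] at h1
  rwa [mul_comm (n : ℝ), ENNReal.ofReal_mul (sq_nonneg ε), ENNReal.ofReal_natCast]

theorem mem_klBall_of_klDiv_le {n : ℕ} (hn : n ≠ 0) {ε : ℝ} {θ₀ θ : Param k} (hθ : θ ∈ Θ)
    (hkl : InformationTheory.klDiv (dist μ q n θ₀) (dist μ q n θ) ≤ ENNReal.ofReal (n * ε ^ 2)) :
    θ ∈ klBall μ q Θ n ε θ₀ := by
  refine ⟨hθ, ?_⟩
  rw [normalizedKL, ENNReal.div_le_iff_le_mul (Or.inl (by exact_mod_cast hn))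
    (Or.inl (ENNReal.natCast_ne_top n))]
  rwa [mul_comm (n : ℝ), ENNReal.ofReal_mul (sq_nonneg ε), ENNReal.ofReal_natCast] at hkl

variable [SigmaFinite μ]

/-- A Kullback-Leibler ball of radius `ε` carries a mass of order at most `(ε √n) ^ k`. -/
theorem exists_ballMass_le (hδ : 0 < δ) (hτ : 0 < τ)
    (hq : ∀ i, IsRegularFamily μ U τ B (h i) (q i)) (hΘ : IsCompact Θ)
    (hΘδ : ∀ θ ∈ Θ, Metric.closedBall θ δ ⊆ U) {J : Param k → Matrix (Fin k) (Fin k) ℝ}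
    (hJ : ∀ θ ∈ Θ, (J θ).PosDef)
    (hlim : ∀ θ ∈ Θ, Tendsto (fun n : ℕ => fisherInfo μ q n θ) atTop (𝓝 (J θ)))
    (hmem : ∀ n y, mle n y ∈ Θ) {c₀ : ℝ} (hc₀ : 0 < c₀) :
    ∃ A : ℝ, 0 < A ∧ ∃ N : ℕ, ∀ n ≥ N, ∀ ε : ℝ, 0 < ε → c₀ ≤ ε ^ 2 * n → ∀ θ₀ ∈ Θ,
      ballMass μ q Θ mle n ε θ₀ ≤ ENNReal.ofReal (A * (ε * √n) ^ k) := by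
  obtain ⟨F, c, hc, N₁, hF, hFc⟩ := exists_finset_hellinger hδ hτ hq hΘ hΘδ hJ hlim
  obtain ⟨A, hA0, N₂, hA⟩ := exists_setLIntegral_ball_le hδ hτ hq
  -- The additive `3` of the covering number is absorbed using `ε √n ≥ √c₀`; this is where the lower
  -- bound on `ε ^ 2 * n` enters.
  set D : ℝ := 2 * (k + 1) * √(2 / c) + 3 / √c₀ with hD
  refine ⟨F.card * (D ^ k * A) + 1, by positivity, max (max N₁ N₂) 1,
    fun n hn ε hε hεn θ₀ hθ₀ => ?_⟩
  have hn1 : 1 ≤ n := (le_max_right _ _).trans hn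
  have hn0 : (0 : ℝ) < n := by exact_mod_cast hn1
  have hnN₁ : N₁ ≤ n := (le_max_left _ _).trans ((le_max_left _ _).trans hn)
  have hnN₂ : N₂ ≤ n := (le_max_right _ _).trans ((le_max_left _ _).trans hn)
  have hsq : √c₀ ≤ ε * √n := by
    rw [← Real.sqrt_sq hε.le, ← Real.sqrt_mul (sq_nonneg ε)]
    exact Real.sqrt_le_sqrt hεn
  have hΘU : ∀ θ ∈ Θ, θ ∈ U := fun θ hθ => hΘδ θ hθ (Metric.mem_closedBall_self hδ.le)
  have hpiece : ∀ S ∈ F, ∃ T : Finset (Param k), (T : Set (Param k)) ⊆ Θ ∧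
      (∀ x ∈ klBall μ q Θ n ε θ₀ ∩ S, ∃ t ∈ T, x ∈ Metric.closedBall t (√n)⁻¹) ∧
      (T.card : ℝ) ≤ (D * (ε * √n)) ^ k := by
    intro S hS
    -- The centre `θ₀` may lie outside `S`, so the Euclidean ball is centred at some point of the
    -- intersection, and distances pass through `θ₀` by the relaxed triangle inequality.
    rcases (klBall μ q Θ n ε θ₀ ∩ S).eq_empty_or_nonempty with he | ⟨θ₁, hθ₁, hθ₁S⟩
    · exact ⟨∅, by simp, by simp [he], by rw [Finset.card_empty, Nat.cast_zero]; positivity⟩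
    have hhel : ∀ θ ∈ klBall μ q Θ n ε θ₀,
        2 * ∑ i : Fin n, (1 - affinity μ (q i) θ₀ θ) ≤ n * ε ^ 2 := fun θ hθ => by
      have h1 := (two_mul_sum_one_sub_affinity_le_klDiv hq (hΘU θ₀ hθ₀) (hΘU θ hθ.1)).trans
        (klDiv_le_of_mem_klBall (by omega) hθ)
      exact (ENNReal.ofReal_le_ofReal_iff (by positivity)).1 h1
    have hsub : klBall μ q Θ n ε θ₀ ∩ S ⊆ Metric.closedBall θ₁ (ε * √(2 / c)) := by
      rintro θ ⟨hθ, hθS⟩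
      rw [mem_closedBall_iff_norm]
      have h1 := hFc S hS n hnN₁ θ hθS θ₁ hθ₁S
      have h2 := Finset.sum_le_sum fun (i : Fin n) (_ : i ∈ Finset.univ) =>
        (hq i).one_sub_affinity_le (hΘU θ hθ.1) (hΘU θ₁ hθ₁.1) (hΘU θ₀ hθ₀)
      rw [Finset.sum_add_distrib, ← Finset.mul_sum, ← Finset.mul_sum] at h2
      have h3 := hhel θ hθ
      have h4 := hhel θ₁ hθ₁
      have h5 : n * (c * ‖θ - θ₁‖ ^ 2) ≤ n * (2 * ε ^ 2) := by linarith
      have h6 := le_of_mul_le_mul_left h5 hn0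
      have h7 : ‖θ - θ₁‖ ^ 2 ≤ (ε * √(2 / c)) ^ 2 := by
        rw [mul_pow, Real.sq_sqrt (by positivity), mul_div_assoc', le_div_iff₀ hc]
        linarith
      exact (pow_le_pow_iff_left₀ (norm_nonneg _) (by positivity) two_ne_zero).1 h7
    obtain ⟨T, hT, hcov, hcard⟩ := exists_finset_cover (r := (√(n : ℝ))⁻¹) (by positivity)
      (by positivity) hsub
    refine ⟨T, fun t ht => (hT ht).1.1, hcov, hcard.trans ?_⟩
    refine pow_le_pow_left₀ (by positivity) ?_ k
    have h8 : 3 ≤ 3 / √c₀ * (ε * √n) := by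
      rw [div_mul_eq_mul_div, le_div_iff₀ (by positivity)]
      linarith
    rw [div_inv_eq_mul, hD, add_mul]
    linarith
  have hball : ∀ S ∈ F,
      ∫⁻ y in {y | mle n y ∈ klBall μ q Θ n ε θ₀ ∩ S},
        ENNReal.ofReal (jointDensity q n y (mle n y)) ∂(Measure.pi fun _ : Fin n => μ) ≤
      ENNReal.ofReal ((D * (ε * √n)) ^ k * A) := by
    intro S hS
    obtain ⟨T, hTΘ, hcov, hcard⟩ := hpiece S hS
    refine (setLIntegral_le_card_mul T (fun t => {y | mle n y ∈ Metric.closedBall t (√n)⁻¹})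
      (fun y hy => hcov _ hy)
      fun t ht => hA n hnN₂ t (hΘδ t (hTΘ (Finset.mem_coe.2 ht))) (mle n)).trans ?_
    rw [← ENNReal.ofReal_natCast, ← ENNReal.ofReal_mul (Nat.cast_nonneg _)]
    exact ENNReal.ofReal_le_ofReal (mul_le_mul_of_nonneg_right hcard hA0)
  refine (setLIntegral_le_card_mul F (fun S => {y | mle n y ∈ klBall μ q Θ n ε θ₀ ∩ S})
    (fun y hy => ?_) hball).trans ?_
  · obtain ⟨S, hS, hyS⟩ := hF (mle n y) (hmem n y)
    exact ⟨S, hS, hy, hyS⟩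
  · rw [← ENNReal.ofReal_natCast, ← ENNReal.ofReal_mul (Nat.cast_nonneg _)]
    refine ENNReal.ofReal_le_ofReal ?_
    have : 0 ≤ (ε * √n) ^ k := by positivity
    rw [mul_pow]
    linarith

/-- There are representative sets with at most `O(ε ^ (-k))` elements. -/
theorem exists_isRepresentative (hδ : 0 < δ) (hτ : 0 < τ)
    (hq : ∀ i, IsRegularFamily μ U τ B (h i) (q i)) (hΘ : IsCompact Θ)
    (hΘδ : ∀ θ ∈ Θ, Metric.closedBall θ δ ⊆ U) (h_mle : IsMLE q Θ mle) {ε₁ : ℝ} (hε₁ : 0 < ε₁) :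
    ∃ D : ℝ, 0 < D ∧ ∀ n : ℕ, n ≠ 0 → ∀ ε : ℝ, 0 < ε → ε ≤ ε₁ →
      ∃ S : Finset (Param k), IsRepresentative μ q Θ mle n ε S ∧ (S.card : ℝ) ≤ (D / ε) ^ k := by
  obtain ⟨η, hη, A, hA0, hA⟩ :=
    IsRegularFamily.exists_integral_log_sub_le (μ := μ) (U := U) (B := B) (k := k) hδ hτ
  obtain ⟨R, hR0, hR⟩ := hΘ.isBounded.subset_closedBall_lt 0 (0 : Param k)
  -- For `ε ≤ ε₁` the radius `κ * ε` stays in the range of the quadratic bound, and `A (κ ε)² ≤ ε²`,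
  -- so Euclidean balls of this radius lie in Kullback-Leibler balls.
  set κ : ℝ := min (η / ε₁) (1 / √(A + 1)) with hκ
  have hκ0 : 0 < κ := by positivity
  refine ⟨2 * (k + 1) * (R / κ) + 3 * ε₁, by positivity, fun n hn ε hε hεε₁ => ?_⟩
  have hκη : κ * ε ≤ η := by
    calc κ * ε ≤ η / ε₁ * ε₁ := by
          gcongr
          exact min_le_left _ _
      _ = η := div_mul_cancel₀ _ hε₁.ne'
  have hκA : A * (κ * ε) ^ 2 ≤ ε ^ 2 := by
    have h1 : κ ^ 2 ≤ 1 / (A + 1) := by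
      calc κ ^ 2 ≤ (1 / √(A + 1)) ^ 2 := by gcongr; exact min_le_right _ _
        _ = _ := by rw [div_pow, one_pow, Real.sq_sqrt (by positivity)]
    rw [le_div_iff₀ (by positivity)] at h1
    have h2 : A * κ ^ 2 ≤ 1 := by nlinarith [sq_nonneg κ]
    have h3 := mul_le_mul_of_nonneg_right h2 (sq_nonneg ε)
    rw [mul_pow]
    linarith
  obtain ⟨S, hSΘ, hcov, hcard⟩ := exists_finset_cover (r := κ * ε) (by positivity) hR0.le hR
  refine ⟨S, ⟨hSΘ, ?_⟩, hcard.trans ?_⟩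
  · rw [complexity_eq_lintegral μ h_mle]
    have hsub : (Set.univ : Set (Fin n → X)) ⊆
        ⋃ s : S, {y | mle n y ∈ klBall μ q Θ n ε s} := fun y _ => by
      obtain ⟨s, hs, hys⟩ := hcov _ (h_mle.mem n y)
      refine Set.mem_iUnion.2 ⟨⟨s, hs⟩, mem_klBall_of_klDiv_le hn (h_mle.mem n y) ?_⟩
      have hnorm : ‖mle n y - s‖ ≤ κ * ε := mem_closedBall_iff_norm.1 hys
      have hsδ := hΘδ s (hSΘ (Finset.mem_coe.2 hs))
      have h1 := fun i => hA (h i) (q i) (hq i) s hsδ (mle n y) (hnorm.trans hκη)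
      refine klDiv_dist_le hq (hsδ (Metric.mem_closedBall_self hδ.le)) (h1 0).1
        (fun i => (h1 i).2.1) fun i => (h1 i).2.2.trans (le_trans ?_ hκA)
      gcongr
    rw [← setLIntegral_univ]
    refine (lintegral_mono_set hsub).trans ((lintegral_iUnion_le _ _).trans ?_)
    rw [tsum_fintype, Finset.sum_coe_sort S fun s => ∫⁻ y in {y | mle n y ∈ klBall μ q Θ n ε s},
      ENNReal.ofReal (jointDensity q n y (mle n y)) ∂(Measure.pi fun _ : Fin n => μ)]
    rfl
  · refine pow_le_pow_left₀ (by positivity) ?_ k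
    rw [le_div_iff₀ hε]
    have e : (2 * (k + 1) * (R / (κ * ε)) + 3) * ε = 2 * (k + 1) * (R / κ) + 3 * ε := by
      field_simp
    rw [e]
    linarith

/-- The complexity is of order at least `n ^ (k / 2)`. -/
theorem exists_le_complexity (hδ : 0 < δ) (hτ : 0 < τ)
    (hq : ∀ i, IsRegularFamily μ U τ B (h i) (q i))
    (hΘδ : ∀ θ ∈ Θ, Metric.closedBall θ δ ⊆ U) {J : Param k → Matrix (Fin k) (Fin k) ℝ}
    (hJ : ∀ θ ∈ Θ, (J θ).PosDef)
    (hlim : ∀ θ ∈ Θ, Tendsto (fun n : ℕ => fisherInfo μ q n θ) atTop (𝓝 (J θ)))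
    (h_mle : IsMLE q Θ mle) (hint : (interior Θ).Nonempty) :
    ∃ a : ℝ, 0 < a ∧ ∃ N : ℕ, ∀ n ≥ N, complexity μ q Θ n ≠ ∞ →
      a * √n ^ k ≤ (complexity μ q Θ n).toReal := by
  obtain ⟨θ₀, hθ₀⟩ := hint
  obtain ⟨r₁, hr₁, c, hc, N, hN⟩ := exists_local_hellinger hδ hτ hq
    (hΘδ θ₀ (interior_subset hθ₀)) (hJ θ₀ (interior_subset hθ₀)) (hlim θ₀ (interior_subset hθ₀))
  obtain ⟨r₂, hr₂, hr₂Θ⟩ := Metric.nhds_basis_closedBall.mem_iff.1 (mem_interior_iff_mem_nhds.1 hθ₀)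
  set r := min r₁ r₂ with hr
  have hr0 : 0 < r := lt_min hr₁ hr₂
  set L : ℝ := ∑' d : ℤ, Real.exp (-c * (d : ℝ) ^ 2) with hL
  have hL0 : 0 < L := tsum_exp_neg_mul_sq_pos hc
  refine ⟨(r / (k + 1)) ^ k / L ^ k, by positivity, max N 1, fun n hn hfin => ?_⟩
  have hn1 : 1 ≤ n := (le_max_right _ _).trans hn
  have hn0 : (0 : ℝ) < n := by exact_mod_cast hn1
  have hsn : 0 < √(n : ℝ) := Real.sqrt_pos.2 hn0
  -- Largest coordinate keeping the lattice `θ₀ + z / √n`, `z ∈ {0, …, m}^k`, in the ball of radius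
  -- `r`; its `(m + 1)^k` points number at least `(r √n / (k + 1))^k`.
  set m : ℕ := ⌊r * √n / (k + 1)⌋₊ with hm
  set Z : Finset (Fin k → ℕ) := Fintype.piFinset fun _ => Finset.range (m + 1) with hZ
  let v : (Fin k → ℕ) → Param k := fun z => WithLp.toLp 2 fun j => (z j : ℝ)
  let t : (Fin k → ℕ) → Param k := fun z => θ₀ + (√(n : ℝ))⁻¹ • v z
  have ht : ∀ z ∈ Z, t z ∈ Metric.closedBall θ₀ r := fun z hz => by
    rw [mem_closedBall_iff_norm, add_sub_cancel_left, norm_smul, norm_inv,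
      Real.norm_of_nonneg hsn.le, inv_mul_le_iff₀ hsn]
    have h1 : ‖v z‖ ≤ k * m := by
      refine (norm_le_sum_abs _).trans ?_
      have := Finset.sum_le_card_nsmul Finset.univ (fun j => |v z j|) (m : ℝ) fun j _ => by
        have h2 := Finset.mem_range.1 (Fintype.mem_piFinset.1 hz j)
        have h3 : v z j = (z j : ℝ) := rfl
        rw [h3, abs_of_nonneg (Nat.cast_nonneg _)]
        exact_mod_cast Nat.lt_succ_iff.1 h2
      simpa using this
    have h2 : (m : ℝ) ≤ r * √n / (k + 1) := Nat.floor_le (by positivity)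
    rw [le_div_iff₀ (by positivity)] at h2
    have h3 : (0 : ℝ) ≤ m := Nat.cast_nonneg m
    linarith
  have htΘ : ∀ z ∈ Z, t z ∈ Θ := fun z hz =>
    hr₂Θ (Metric.closedBall_subset_closedBall (min_le_right _ _) (ht z hz))
  have htU : ∀ z ∈ Z, t z ∈ U := fun z hz =>
    hΘδ _ (htΘ z hz) (Metric.mem_closedBall_self hδ.le)
  have haff : ∀ z ∈ Z, ∀ z' ∈ Z, ∏ i : Fin n, affinity μ (q i) (t z) (t z') ≤
      ∏ j, Real.exp (-c * ((z j : ℝ) - z' j) ^ 2) := fun z hz z' hz' => by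
    refine (prod_affinity_le_exp hq (htU z hz) (htU z' hz')).trans ?_
    rw [← Real.exp_sum]
    refine Real.exp_le_exp.2 ?_
    have h1 := hN n ((le_max_left _ _).trans hn) _
      (Metric.closedBall_subset_closedBall (min_le_left _ _) (ht z hz)) _
      (Metric.closedBall_subset_closedBall (min_le_left _ _) (ht z' hz'))
    have h2 : ‖t z - t z'‖ ^ 2 = (n : ℝ)⁻¹ * ∑ j, ((z j : ℝ) - z' j) ^ 2 := by
      have e : t z - t z' = (√(n : ℝ))⁻¹ • (v z - v z') := by
        simp only [t, smul_sub]; abel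
      rw [e, norm_smul, mul_pow, norm_inv, Real.norm_of_nonneg hsn.le, inv_pow,
        Real.sq_sqrt hn0.le, EuclideanSpace.real_norm_sq_eq]
      rfl
    rw [h2] at h1
    have e : n * c * ((n : ℝ)⁻¹ * ∑ j, ((z j : ℝ) - z' j) ^ 2) =
        c * ∑ j, ((z j : ℝ) - z' j) ^ 2 := by field_simp
    rw [e] at h1
    rw [← Finset.mul_sum]
    linarith
  -- Row sums of the Gram matrix: the Gaussian bound factorises over coordinates, each factor at
  -- most `L`.
  have hrow : ∀ z ∈ Z, ∑ z' ∈ Z, ∏ i : Fin n, affinity μ (q i) (t z) (t z') ≤ L ^ k :=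
    fun z hz => by
    refine (Finset.sum_le_sum fun z' hz' => haff z hz z' hz').trans ?_
    rw [hZ, ← Finset.prod_univ_sum (t := fun _ : Fin k => Finset.range (m + 1))
      (f := fun j l => Real.exp (-c * ((z j : ℝ) - l) ^ 2))]
    calc _ ≤ ∏ _j : Fin k, L := Finset.prod_le_prod
          (fun j _ => Finset.sum_nonneg fun _ _ => (Real.exp_pos _).le)
          fun j _ => sum_exp_neg_mul_sq_le hc (m + 1) (z j)
      _ = L ^ k := by simp
  set G : (Fin n → X) → ℝ := fun y =>
    ∑ z ∈ Z, ∑ z' ∈ Z, √(jointDensity q n y (t z)) * √(jointDensity q n y (t z')) with hG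
  have hGi : Integrable G (Measure.pi fun _ : Fin n => μ) :=
    integrable_finsetSum _ fun z hz => integrable_finsetSum _ fun z' hz' =>
      integrable_sqrt_jointDensity_mul hq (htU z hz) (htU z' hz')
  have hGint : ∫ y, G y ∂(Measure.pi fun _ : Fin n => μ) ≤ Z.card * L ^ k := by
    rw [hG, integral_finsetSum _ fun z hz => integrable_finsetSum _ fun z' hz' =>
      integrable_sqrt_jointDensity_mul hq (htU z hz) (htU z' hz')]
    have : ∀ z ∈ Z, ∫ y, ∑ z' ∈ Z, √(jointDensity q n y (t z)) * √(jointDensity q n y (t z'))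
        ∂(Measure.pi fun _ : Fin n => μ) ≤ L ^ k := fun z hz => by
      rw [integral_finsetSum _ fun z' hz' =>
        integrable_sqrt_jointDensity_mul hq (htU z hz) (htU z' hz')]
      refine le_trans (Finset.sum_le_sum fun z' hz' => ?_) (hrow z hz)
      exact (integral_sqrt_jointDensity_mul hq (htU z hz) (htU z' hz')).le
    have := Finset.sum_le_card_nsmul _ _ _ this
    rwa [nsmul_eq_mul] at this
  have hG0 : ∀ y, 0 ≤ G y := fun y => Finset.sum_nonneg fun _ _ => Finset.sum_nonneg fun _ _ =>
    mul_nonneg (Real.sqrt_nonneg _) (Real.sqrt_nonneg _)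
  have hmle : ∀ y, 0 < jointDensity q n y (mle n y) := fun y =>
    jointDensity_pos (fun i => (hq i).pos)
      (hΘδ _ (h_mle.mem n y) (Metric.mem_closedBall_self hδ.le)) y
  -- Each lattice density is at most the geometric mean of itself and the maximum. Summation and
  -- AM-GM follow, with weight `L ^ k` chosen so that the integral of the `G` term is at most half
  -- of `Z.card` and can be moved to the left.
  have hpt : ∀ y, ∑ z ∈ Z, jointDensity q n y (t z) ≤
      L ^ k / 2 * jointDensity q n y (mle n y) + (2 * L ^ k)⁻¹ * G y := fun y => by
    have h1 : ∀ z ∈ Z, jointDensity q n y (t z) ≤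
        √(jointDensity q n y (mle n y)) * √(jointDensity q n y (t z)) := fun z hz => by
      have hp := jointDensity_pos (fun i => (hq i).pos) (htU z hz) y
      conv_lhs => rw [← Real.mul_self_sqrt hp.le]
      exact mul_le_mul_of_nonneg_right
        (Real.sqrt_le_sqrt (h_mle.isMax n y _ (htΘ z hz))) (Real.sqrt_nonneg _)
    have h2 := Finset.sum_le_sum h1
    rw [← Finset.mul_sum] at h2
    have h3 : G y = (∑ z ∈ Z, √(jointDensity q n y (t z))) ^ 2 := by
      rw [hG, sq, Finset.sum_mul_sum]
    have h4 := Real.sq_sqrt (hmle y).le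
    refine h2.trans ?_
    rw [h3, ← h4, Real.sqrt_sq (Real.sqrt_nonneg _)]
    have hLk : 0 < L ^ k := by positivity
    rw [← sub_nonneg]
    have e : L ^ k / 2 * √(jointDensity q n y (mle n y)) ^ 2 +
        (2 * L ^ k)⁻¹ * (∑ z ∈ Z, √(jointDensity q n y (t z))) ^ 2 -
        √(jointDensity q n y (mle n y)) * ∑ z ∈ Z, √(jointDensity q n y (t z)) =
        (2 * L ^ k)⁻¹ * (L ^ k * √(jointDensity q n y (mle n y)) -
          ∑ z ∈ Z, √(jointDensity q n y (t z))) ^ 2 := by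
      field_simp
      ring
    rw [e]
    positivity
  have hlint : (Z.card : ℝ≥0∞) ≤ ENNReal.ofReal (L ^ k / 2) * complexity μ q Θ n +
      ENNReal.ofReal ((2 * L ^ k)⁻¹ * (Z.card * L ^ k)) := by
    calc (Z.card : ℝ≥0∞) = ∫⁻ y, ∑ z ∈ Z, ENNReal.ofReal (jointDensity q n y (t z))
          ∂(Measure.pi fun _ : Fin n => μ) := by
          rw [lintegral_finsetSum' _ fun z hz =>
            (measurable_jointDensity hq (htU z hz)).ennreal_ofReal.aemeasurable,
            Finset.sum_congr rfl fun z hz => lintegral_jointDensity hq (htU z hz)]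
          simp
      _ ≤ ∫⁻ y, (ENNReal.ofReal (L ^ k / 2) * ENNReal.ofReal (jointDensity q n y (mle n y)) +
          ENNReal.ofReal ((2 * L ^ k)⁻¹ * G y)) ∂(Measure.pi fun _ : Fin n => μ) := by
          refine lintegral_mono fun y => ?_
          rw [← ENNReal.ofReal_sum_of_nonneg fun z hz =>
            (jointDensity_pos (fun i => (hq i).pos) (htU z hz) y).le,
            ← ENNReal.ofReal_mul (by positivity),
            ← ENNReal.ofReal_add (mul_nonneg (by positivity) (hmle y).le)
              (mul_nonneg (by positivity) (hG0 y))]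
          exact ENNReal.ofReal_le_ofReal (hpt y)
      _ = ENNReal.ofReal (L ^ k / 2) * complexity μ q Θ n +
          ENNReal.ofReal (∫ y, (2 * L ^ k)⁻¹ * G y ∂(Measure.pi fun _ : Fin n => μ)) := by
          -- Additivity is taken from the measurability of the second summand; measurability of the
          -- maximised likelihood is not required.
          rw [lintegral_add_right', lintegral_const_mul' _ _ ENNReal.ofReal_ne_top,
            complexity_eq_lintegral μ h_mle, ofReal_integral_eq_lintegral_ofReal
              (hGi.const_mul _) (ae_of_all _ fun y => mul_nonneg (by positivity) (hG0 y))]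
          exact (hGi.const_mul _).aestronglyMeasurable.aemeasurable.ennreal_ofReal
      _ ≤ _ := by
          rw [integral_const_mul]
          gcongr
  have hreal : (Z.card : ℝ) ≤ L ^ k / 2 * (complexity μ q Θ n).toReal + Z.card / 2 := by
    have hLk : 0 < L ^ k := by positivity
    have e : (2 * L ^ k)⁻¹ * (Z.card * L ^ k) = (Z.card : ℝ) / 2 := by field_simp
    rw [e] at hlint
    have h1 := ENNReal.toReal_mono (ENNReal.add_ne_top.2
      ⟨ENNReal.mul_ne_top ENNReal.ofReal_ne_top hfin, ENNReal.ofReal_ne_top⟩) hlint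
    rwa [ENNReal.toReal_add (ENNReal.mul_ne_top ENNReal.ofReal_ne_top hfin) ENNReal.ofReal_ne_top,
      ENNReal.toReal_mul, ENNReal.toReal_ofReal (by positivity),
      ENNReal.toReal_ofReal (by positivity), ENNReal.toReal_natCast] at h1
  have hcard : (r * √n / (k + 1)) ^ k ≤ (Z.card : ℝ) := by
    rw [hZ, Fintype.card_piFinset]
    simp only [Finset.card_range, Finset.prod_const, Finset.card_univ, Fintype.card_fin]
    push_cast
    exact pow_le_pow_left₀ (by positivity) (Nat.lt_floor_add_one _).le k
  have e : (r / (k + 1)) ^ k / L ^ k * √n ^ k = (r * √n / (k + 1)) ^ k / L ^ k := by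
    rw [div_mul_eq_mul_div, ← mul_pow]
    congr 2
    ring
  rw [e, div_le_iff₀ (by positivity)]
  linarith

end Counting

end DescriptiveDim

/-! ### Combination of the three estimates. -/

theorem mainTheorem4 {X : Type*} [MeasurableSpace X] (μ : Measure X) [SigmaFinite μ] (k : ℕ)
    (q : ℕ → X → DescriptiveDim.Param k → ℝ)
    (U Θ : Set (DescriptiveDim.Param k))
    (hU : IsOpen U) (hΘ : IsCompact Θ) (hΘU : Θ ⊆ U) (hΘint : (interior Θ).Nonempty)
    -- for `θ ∈ U`, `q i · θ` is a positive probability density with respect to `μ`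
    (hq_meas : ∀ i, ∀ θ ∈ U, Measurable fun x => q i x θ)
    (hq_pos : ∀ i x, ∀ θ ∈ U, 0 < q i x θ)
    (hq_one : ∀ i, ∀ θ ∈ U, ∫⁻ x, ENNReal.ofReal (q i x θ) ∂μ = 1)
    -- the log-density is `C^3` in `θ`; its derivatives of orders two and three have an
    -- envelope `h` with a uniformly bounded exponential moment
    (hq_smooth : ∀ i x, ContDiffOn ℝ 3 (fun θ => Real.log (q i x θ)) U)
    (h : ℕ → X → ℝ) (h_meas : ∀ i, Measurable (h i))
    (h_two : ∀ i x, ∀ θ ∈ U, ‖iteratedFDeriv ℝ 2 (fun t => Real.log (q i x t)) θ‖ ≤ h i x)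
    (h_three : ∀ i x, ∀ θ ∈ U, ‖iteratedFDeriv ℝ 3 (fun t => Real.log (q i x t)) θ‖ ≤ h i x)
    (τ B : ℝ) (hτ : 0 < τ)
    (h_exp : ∀ i, ∀ θ ∈ U,
      ∫⁻ x, ENNReal.ofReal (Real.exp (τ * h i x) * q i x θ) ∂μ ≤ ENNReal.ofReal B)
    -- the Fisher information matrices converge to a positive definite limit
    (J : DescriptiveDim.Param k → Matrix (Fin k) (Fin k) ℝ)
    (hJ_lim : ∀ θ ∈ Θ, Tendsto (fun n : ℕ => DescriptiveDim.fisherInfo μ q n θ) atTop (𝓝 (J θ)))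
    (hJ_pos : ∀ θ ∈ Θ, (J θ).PosDef)
    -- the maximum likelihood estimator and its central limit theorem
    (mle : (n : ℕ) → (Fin n → X) → DescriptiveDim.Param k)
    (h_mle : DescriptiveDim.IsMLE q Θ mle)
    (h_clt : ∀ θ ∈ interior Θ, DescriptiveDim.MLECentralLimit μ q mle (J θ) θ)
    (c : ℝ) (hc : 0 < c) (ε₁ : ℝ) :
    ∃ (K : ℝ) (N : ℕ), ∀ n : ℕ, N ≤ n → ∀ ε : ℝ, 0 < ε → ε ≤ ε₁ → c ≤ ε ^ 2 * n →
      DescriptiveDim.complexity μ q Θ n ≠ ∞ ∧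
      (∃ S : Finset (DescriptiveDim.Param k),
        DescriptiveDim.IsRepresentative μ q Θ mle n ε S) ∧
      |Real.log (DescriptiveDim.complexity μ q Θ n).toReal -
        (Real.log (DescriptiveDim.repCount μ q Θ mle n ε : ℝ) +
          (k : ℝ) / 2 * Real.log (ε ^ 2 * n))| ≤ K := by
  -- A uniform margin around `Θ` inside `U`, so all local estimates hold with common constants, also
  -- at boundary points of `Θ`.
  obtain ⟨δ, hδ, hδU⟩ := hΘ.exists_cthickening_subset_open hU hΘU
  have hΘδ : ∀ θ ∈ Θ, Metric.closedBall θ δ ⊆ U := fun θ hθ =>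
    (Metric.closedBall_subset_cthickening hθ δ).trans hδU
  have hq : ∀ i, DescriptiveDim.IsRegularFamily μ U τ B (h i) (q i) := fun i =>
    { isOpen := hU
      meas := hq_meas i
      pos := hq_pos i
      one := hq_one i
      smooth := fun x => (hq_smooth i x).of_le (by norm_num)
      h_meas := h_meas i
      two := fun x θ hθ => by
        rw [← norm_iteratedFDeriv_one, norm_iteratedFDeriv_fderiv]
        exact h_two i x θ hθ
      exp := h_exp i }
  obtain ⟨A, hA0, N₁, hA⟩ := DescriptiveDim.exists_ballMass_le hδ hτ hq hΘ hΘδ hJ_pos hJ_lim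
    h_mle.mem hc
  -- The maximum with `1` supplies a positive bound, as `ε₁` itself may have any sign.
  obtain ⟨D, hD0, hD⟩ := DescriptiveDim.exists_isRepresentative hδ hτ hq hΘ hΘδ h_mle
    (lt_max_of_lt_right one_pos : 0 < max ε₁ 1)
  obtain ⟨a, ha0, N₂, ha⟩ := DescriptiveDim.exists_le_complexity hδ hτ hq hΘδ hJ_pos hJ_lim
    h_mle hΘint
  refine ⟨|Real.log A| + |Real.log a| + k * |Real.log D|, max (max N₁ N₂) 1,
    fun n hn ε hε hε₁ hεn => ?_⟩
  have hn1 : 1 ≤ n := (le_max_right _ _).trans hn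
  have hn0 : (0 : ℝ) < n := by exact_mod_cast hn1
  have hsn : 0 < √(n : ℝ) := Real.sqrt_pos.2 hn0
  have hball := hA n ((le_max_left _ _).trans ((le_max_left _ _).trans hn)) ε hε hεn
  have hsum : ∀ S : Finset (DescriptiveDim.Param k),
      DescriptiveDim.IsRepresentative μ q Θ mle n ε S →
        DescriptiveDim.complexity μ q Θ n ≤ ENNReal.ofReal (S.card * (A * (ε * √n) ^ k)) := by
    intro S hS
    refine hS.2.trans ((Finset.sum_le_card_nsmul _ _ _ fun θ hθ =>
      hball θ (hS.1 (Finset.mem_coe.2 hθ))).trans ?_)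
    rw [nsmul_eq_mul, ENNReal.ofReal_mul (Nat.cast_nonneg _), ENNReal.ofReal_natCast]
  obtain ⟨S, hS, hScard⟩ := hD n (by omega) ε hε (hε₁.trans (le_max_left _ _))
  have hfin : DescriptiveDim.complexity μ q Θ n ≠ ∞ :=
    ((hsum S hS).trans_lt ENNReal.ofReal_lt_top).ne
  refine ⟨hfin, ⟨S, hS⟩, ?_⟩
  have hlow := ha n ((le_max_right _ _).trans ((le_max_left _ _).trans hn)) hfin
  obtain ⟨S', hS', hcard'⟩ : ∃ S' : Finset (DescriptiveDim.Param k),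
      DescriptiveDim.IsRepresentative μ q Θ mle n ε S' ∧
        S'.card = DescriptiveDim.repCount μ q Θ mle n ε :=
    Nat.sInf_mem (s := {m | ∃ S : Finset (DescriptiveDim.Param k),
      DescriptiveDim.IsRepresentative μ q Θ mle n ε S ∧ S.card = m}) ⟨S.card, S, hS, rfl⟩
  have hmle : DescriptiveDim.repCount μ q Θ mle n ε ≤ S.card := Nat.sInf_le ⟨S, hS, rfl⟩
  set M : ℕ := DescriptiveDim.repCount μ q Θ mle n ε with hM
  set C : ℝ := (DescriptiveDim.complexity μ q Θ n).toReal with hC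
  have hC0 : 0 < C := lt_of_lt_of_le (by positivity) hlow
  have hup : C ≤ M * (A * (ε * √n) ^ k) := by
    have h1 := ENNReal.toReal_le_of_le_ofReal (by positivity) (hsum S' hS')
    rwa [hcard'] at h1
  -- An empty representative set would force the complexity to vanish, against its lower bound; so
  -- `log M` is a genuine logarithm.
  have hM0 : (0 : ℝ) < M := by
    rcases Nat.eq_zero_or_pos M with h0 | h0
    · rw [h0, Nat.cast_zero, zero_mul] at hup
      exact absurd hup hC0.not_ge
    · exact_mod_cast h0
  have hMD : (M : ℝ) ≤ (D / ε) ^ k := (Nat.cast_le.2 hmle).trans hScard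
  have l1 : Real.log C ≤ Real.log M + (Real.log A + k * (Real.log ε + Real.log √n)) := by
    have h1 := Real.log_le_log hC0 hup
    rwa [Real.log_mul hM0.ne' (by positivity), Real.log_mul hA0.ne' (by positivity), Real.log_pow,
      Real.log_mul hε.ne' hsn.ne'] at h1
  have l2 : Real.log a + k * Real.log √n ≤ Real.log C := by
    have h1 := Real.log_le_log (by positivity) hlow
    rwa [Real.log_mul ha0.ne' (by positivity), Real.log_pow] at h1
  have l3 : Real.log M ≤ k * (Real.log D - Real.log ε) := by
    have h1 := Real.log_le_log hM0 hMD
    rwa [Real.log_pow, Real.log_div hD0.ne' hε.ne'] at h1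
  have l4 : (k : ℝ) / 2 * Real.log (ε ^ 2 * n) = k * (Real.log ε + Real.log √n) := by
    rw [Real.log_mul (by positivity) hn0.ne', Real.log_pow, Real.log_sqrt hn0.le]
    push_cast
    ring
  have hk : (0 : ℝ) ≤ k := Nat.cast_nonneg k
  have b1 := neg_abs_le (Real.log a)
  have b2 := le_abs_self (Real.log A)
  have b3 : k * Real.log D ≤ k * |Real.log D| := mul_le_mul_of_nonneg_left (le_abs_self _) hk
  have b4 := abs_nonneg (Real.log a)
  have b5 := abs_nonneg (Real.log A)
  have b6 : (0 : ℝ) ≤ k * |Real.log D| := by positivity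
  rw [l4, abs_le]
  constructor <;> linarith
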